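/- Let $A=(a_1\,\cdots\,a_n)\in\mathbb{Z}^{d\times n}$ be a matrix of rank $n-1$ and let $b\in\mathbb{C}^n$. Set $\beta_j=e^{-i b_j\pi/2}$ for $j=1,\dots,n$, and let $$\mathcal{L}_{A,b}=\{(\cos(w_1-\tfrac{b_1\pi}{2}),\dots,\cos(w_n-\tfrac{b_n\pi}{2})) : w\in \mathrm{Row}(A)\}\subseteq\mathbb{C}^n,$$ where $\mathrm{Row}(A)\subseteq\mathbb{C}^n$ is the $\mathbb{C}$-span of the rows of $A$. Let $Y_A\subseteq\mathbb{C}^n$ be the Zariski closure of $\{(v^{a_1},\dots,v^{a_n}) : v\in(\mathbb{C}^*)^d\}$, let $Y_{A,\beta}=\{(\beta_1y_1,\dots,\beta_ny_n): y\in Y_A\}$, and let $$\mathcal{Y}_{A,b}=\{(x,y)\in\mathbb{C}^n\times(\mathbb{C}^*)^n : y\in Y_{A,\beta},\ x_j=\tfrac12(y_j+y_j^{-1}) \text{ for } j=1,\dots,n\}.$$ Let $\pi_{A,b}:\mathcal{Y}_{A,b}\to\mathcal{L}_{A,b}$, $(x,y)\mapsto x$, and let $\deg\pi_{A,b}$ be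 the cardinality of its generic fiber, that is, the number $k$ such that all fibers over some nonempty Zariski open subset of $\mathcal{L}_{A,b}$ have exactly $k$ points. Let $g$ be a generator of the toric ideal of $Y_{A,\beta}$: either $g\in\mathbb{C}[y_1,\dots,y_n]$ generates the vanishing ideal of $Y_{A,\beta}$, or $g\in\mathbb{C}[y_1^{\pm1},\dots,y_n^{\pm1}]$ generates the ideal of $Y_{A,\beta}\cap(\mathbb{C}^*)^n$. Let $K=\overline{\mathbb{C}(x_1,\dots,x_n)}$ and $$\mathcal{A}=K[y_1^{\pm1},\dots,y_n^{\pm1}]/\langle 2x_1-y_1-y_1^{-1},\dots,2x_n-y_n-y_n^{-1}\rangle,$$ a $K$-vector space of dimension $2^n$, and let $M_g$ be a $2^n\times2^n$ matrix with entries in $\mathbb{C}[x]=\mathbb{C}[x_1,\dots,x_n]$ which represents the multiplication map $\mathcal{A}\to\mathcal{A}$, $[h]\mapsto[gh]$, in some $K$-basis of $\mathcal{A}$ (for instance in the basis of the monomials $y^s$, $s\in\{0,1\}^n$). Then $$\mathcal{L}_{A,b}=\{x\in\mathbb{C}^n : \det M_g(x)=0\}.$$ Moreover, $\deg\pi_{A,b}$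 is well defined, and if the (prime) vanishing ideal of $\mathcal{L}_{A,b}$ is $\langle f\rangle\subset\mathbb{C}[x]$, then $\det M_g=c\,f^{\deg\pi_{A,b}}$ for some $c\in\mathbb{C}^*$. -/

import Mathlib

open MvPolynomial

noncomputable section

namespace Lissajous

/-! ## Laurent polynomials -/

/-- The Laurent polynomial ring `R[y₁^{±1}, …, y_n^{±1}]`: the group algebra of `ℤⁿ`. -/
abbrev Laurent (n : ℕ) (R : Type*) [CommRing R] : Type _ :=
  AddMonoidAlgebra R (Fin n → ℤ)

/-- The Laurent monomial `y^m`. -/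
def mono {n : ℕ} (R : Type*) [CommRing R] (m : Fin n → ℤ) : Laurent n R :=
  AddMonoidAlgebra.single m 1

/-- The character `m ↦ u^m = ∏ⱼ uⱼ^{mⱼ}` attached to a tuple of units. -/
def unitMonomial {n : ℕ} {T : Type*} [CommRing T] (u : Fin n → Tˣ) :
    Multiplicative (Fin n → ℤ) →* T where
  toFun m := ((∏ j, u j ^ (m.toAdd j) : Tˣ) : T)
  map_one' := by simp
  map_mul' a b := by simp [zpow_add, Finset.prod_mul_distrib]

/-- Evaluation of a Laurent polynomial at a tuple of units. -/
def evalLaurent {n : ℕ} {R T : Type*} [CommRing R] [CommRing T] [Algebra R T] (u : Fin n → Tˣ) :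
    Laurent n R →ₐ[R] T :=
  AddMonoidAlgebra.lift R T (Fin n → ℤ) (unitMonomial u)

/-- The inclusion `R[y₁, …, y_n] ⊆ R[y₁^{±1}, …, y_n^{±1}]`. -/
def polyToLaurent {n : ℕ} {R : Type*} [CommRing R] : MvPolynomial (Fin n) R →ₐ[R] Laurent n R :=
  MvPolynomial.aeval (fun j => mono R (Pi.single j 1))

/-! ## The varieties -/

/-- The Zariski closure of a subset of `ℂⁿ`. -/
def zariskiClosure {n : ℕ} (S : Set (Fin n → ℂ)) : Set (Fin n → ℂ) :=
  zeroLocus ℂ (vanishingIdeal ℂ S)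

/-- The row space of `A`: the `ℂ`-span of its rows. -/
def rowSpace {d n : ℕ} (A : Matrix (Fin d) (Fin n) ℤ) : Submodule ℂ (Fin n → ℂ) :=
  Submodule.span ℂ (Set.range fun k : Fin d => fun j : Fin n => (A k j : ℂ))

/-- The Lissajous variety `cos(Row(A) - bπ/2)`. -/
def lissajous {d n : ℕ} (A : Matrix (Fin d) (Fin n) ℤ) (b : Fin n → ℂ) : Set (Fin n → ℂ) :=
  {x | ∃ w ∈ rowSpace A, ∀ j, x j = Complex.cos (w j - b j * (Real.pi : ℂ) / 2)}

/-- `βⱼ = exp(-i bⱼ π/2)`. -/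
def beta {n : ℕ} (b : Fin n → ℂ) (j : Fin n) : ℂ :=
  Complex.exp (-Complex.I * b j * (Real.pi : ℂ) / 2)

/-- The affine toric variety `Y_A`: the closure of the image of
`v ↦ (v^{a₁}, …, v^{a_n})`, where `aⱼ` is the `j`-th column of `A`. -/
def toricVariety {d n : ℕ} (A : Matrix (Fin d) (Fin n) ℤ) : Set (Fin n → ℂ) :=
  zariskiClosure (Set.range fun v : Fin d → ℂˣ =>
    fun j : Fin n => ((∏ k, v k ^ A k j : ℂˣ) : ℂ))

/-- The scaled toric variety `Y_{A,β}`. -/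
def scaledToricVariety {d n : ℕ} (A : Matrix (Fin d) (Fin n) ℤ) (β : Fin n → ℂ) :
    Set (Fin n → ℂ) :=
  (fun y : Fin n → ℂ => fun j => β j * y j) '' toricVariety A

/-- The ideal of `Y_{A,β} ∩ (ℂ*)ⁿ` in the Laurent polynomial ring. -/
def torusIdeal {d n : ℕ} (A : Matrix (Fin d) (Fin n) ℤ) (β : Fin n → ℂ) : Ideal (Laurent n ℂ) :=
  ⨅ (y : Fin n → ℂˣ) (_ : (fun j => (y j : ℂ)) ∈ scaledToricVariety A β),
    RingHom.ker (evalLaurent (R := ℂ) y)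

/-- `g` generates the toric ideal of `Y_{A,β}`: either `g` is a polynomial generating the vanishing
ideal of `Y_{A,β}` in `ℂ[y]`, or `g` is a Laurent polynomial generating the
ideal of `Y_{A,β} ∩ (ℂ*)ⁿ` in `ℂ[y^{±1}]`. -/
def GeneratesToricIdeal {d n : ℕ} (A : Matrix (Fin d) (Fin n) ℤ) (β : Fin n → ℂ)
    (g : Laurent n ℂ) : Prop :=
  (∃ p : MvPolynomial (Fin n) ℂ, g = polyToLaurent p ∧
      vanishingIdeal ℂ (scaledToricVariety A β) = Ideal.span {p}) ∨
    torusIdeal A β = Ideal.span {g}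

/-- `𝒴_{A,b} = {(x, y) ∈ ℂⁿ × (ℂ*)ⁿ : y ∈ Y_{A,β}, xⱼ = (yⱼ + yⱼ⁻¹)/2}`. -/
def incidenceVariety {d n : ℕ} (A : Matrix (Fin d) (Fin n) ℤ) (b : Fin n → ℂ) :
    Set ((Fin n → ℂ) × (Fin n → ℂˣ)) :=
  {q | (fun j => (q.2 j : ℂ)) ∈ scaledToricVariety A (beta b) ∧
    ∀ j, q.1 j = ((q.2 j : ℂ) + (q.2 j : ℂ)⁻¹) / 2}

/-- `k` is the degree of `φ : X → Y` (with `Y ⊆ ℂⁿ` irreducible), that is, the cardinality of a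
generic fiber: over the points of some nonempty basic Zariski open subset of `Y`, all
fibers have exactly `k` elements. -/
def IsDegree {n : ℕ} {α : Type*} (X : Set α) (φ : α → (Fin n → ℂ)) (Y : Set (Fin n → ℂ))
    (k : ℕ) : Prop :=
  ∃ p : MvPolynomial (Fin n) ℂ, (∃ x ∈ Y, eval x p ≠ 0) ∧
    ∀ x ∈ Y, eval x p ≠ 0 → {q ∈ X | φ q = x}.encard = k

/-! ## The algebra `𝒜` and multiplication in it -/

/-- The ideal `⟨2xⱼ - yⱼ - yⱼ⁻¹ : j⟩` of `R[y^{±1}]`. -/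
def idealJ {n : ℕ} {R : Type*} [CommRing R] (x : Fin n → R) : Ideal (Laurent n R) :=
  Ideal.span (Set.range fun j =>
    algebraMap R (Laurent n R) (2 * x j) - mono R (Pi.single j 1) - mono R (Pi.single j (-1)))

/-- The algebra `R[y^{±1}] / ⟨2xⱼ - yⱼ - yⱼ⁻¹ : j⟩`. -/
abbrev QuotAlg {n : ℕ} {R : Type*} [CommRing R] (x : Fin n → R) : Type _ :=
  Laurent n R ⧸ idealJ x

/-- `K`, the algebraic closure of the field of rational functions `ℂ(x₁, …, x_n)`. -/
abbrev FieldK (n : ℕ) : Type := AlgebraicClosure (FractionRing (MvPolynomial (Fin n) ℂ))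

/-- The variables `xⱼ`, as elements of `K`. -/
def varK (n : ℕ) (j : Fin n) : FieldK n :=
  algebraMap (MvPolynomial (Fin n) ℂ) (FieldK n) (X j)

/-- The `K`-algebra `𝒜 = K[y^{±1}] / ⟨2xⱼ - yⱼ - yⱼ⁻¹ : j⟩`. -/
abbrev AlgA (n : ℕ) : Type := QuotAlg (varK n)

/-- The class `[g] ∈ 𝒜` of a Laurent polynomial `g ∈ ℂ[y^{±1}] ⊆ K[y^{±1}]`. -/
def classA {n : ℕ} (g : Laurent n ℂ) : AlgA n :=
  Ideal.Quotient.mk (idealJ (varK n))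
    (AddMonoidAlgebra.mapRingHom (Fin n → ℤ)
      ((algebraMap (MvPolynomial (Fin n) ℂ) (FieldK n)).comp C) g)

/-- The multiplication map `M_g : 𝒜 → 𝒜`, `[h] ↦ [g h]`. -/
def mulMap {n : ℕ} (g : Laurent n ℂ) : AlgA n →ₗ[FieldK n] AlgA n :=
  LinearMap.mulLeft (FieldK n) (classA g)

/-- `M` is a matrix with entries in `ℂ[x]` which represents the multiplication
map `M_g` in the `K`-basis `e` of `𝒜`. -/
def IsMultiplicationMatrix {n : ℕ} {ι : Type*} [Fintype ι] [DecidableEq ι]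
    (e : Module.Basis ι (FieldK n) (AlgA n)) (g : Laurent n ℂ)
    (M : Matrix ι ι (MvPolynomial (Fin n) ℂ)) : Prop :=
  M.map (algebraMap (MvPolynomial (Fin n) ℂ) (FieldK n)) = LinearMap.toMatrix e e (mulMap g)

/-! ## The standard multiplication matrices

The remaining part shows that multiplication matrices with entries in `ℂ[x]` exist: with respect to
the basis of monomials `y^s`, `s ∈ {0,1}ⁿ`, one obtains the usual Kronecker products. -/

/-- The invertible matrix `(0, -1; 1, 2x)`. -/
def blockB {R : Type*} [CommRing R] (x : R) : (Matrix (Fin 2) (Fin 2) R)ˣ where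
  val := !![0, -1; 1, 2 * x]
  inv := !![2 * x, 1; -1, 0]
  val_inv := by ext i j; fin_cases i <;> fin_cases j <;> simp
  inv_val := by ext i j; fin_cases i <;> fin_cases j <;> simp

/-- The matrix of `y^m`: the Kronecker product of the powers `B(xⱼ)^{mⱼ}`. -/
def kron {n : ℕ} {R : Type*} [CommRing R] (x : Fin n → R) :
    Multiplicative (Fin n → ℤ) →* Matrix (Fin n → Fin 2) (Fin n → Fin 2) R where
  toFun m := Matrix.of fun s t =>
    ∏ j, ((blockB (x j) ^ (m.toAdd j) : (Matrix (Fin 2) (Fin 2) R)ˣ) :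
      Matrix (Fin 2) (Fin 2) R) (s j) (t j)
  map_one' := by
    ext s t
    simp only [toAdd_one, Pi.zero_apply, zpow_zero, Units.val_one, Matrix.of_apply,
      Matrix.one_apply]
    by_cases h : s = t
    · simp [h]
    · obtain ⟨j, hj⟩ := Function.ne_iff.1 h
      rw [if_neg h]
      exact Finset.prod_eq_zero (Finset.mem_univ j) (if_neg hj)
  map_mul' a b := by
    ext s t
    simp only [toAdd_mul, Pi.add_apply, zpow_add, Units.val_mul, Matrix.of_apply,
      Matrix.mul_apply, ← Finset.prod_mul_distrib]
    rw [Finset.prod_univ_sum]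
    simp

/-- Substitution of the Kronecker products for the variables `yⱼ` in a Laurent polynomial. -/
def kronMatrix {n : ℕ} {R : Type*} [CommRing R] (x : Fin n → R) :
    Laurent n R →ₐ[R] Matrix (Fin n → Fin 2) (Fin n → Fin 2) R :=
  AddMonoidAlgebra.lift R _ (Fin n → ℤ) (kron x)

/-- The class of the monomial `y^s`, `s ∈ {0,1}ⁿ`. -/
def monoClass {n : ℕ} {R : Type*} [CommRing R] (x : Fin n → R) (s : Fin n → Fin 2) : QuotAlg x :=
  Ideal.Quotient.mk (idealJ x) (mono R fun j => ((s j : ℕ) : ℤ))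

/-- The standard multiplication matrix of a Laurent polynomial `g ∈ ℂ[y^{±1}]`, with entries
in `ℂ[x]`. -/
def stdMatrix {n : ℕ} (g : Laurent n ℂ) :
    Matrix (Fin n → Fin 2) (Fin n → Fin 2) (MvPolynomial (Fin n) ℂ) :=
  kronMatrix (fun j => X j) (AddMonoidAlgebra.mapRingHom (Fin n → ℤ) C g)

theorem mono_add {n : ℕ} {R : Type*} [CommRing R] (a b : Fin n → ℤ) :
    mono R (a + b) = mono R a * mono R b := by
  simp [mono, AddMonoidAlgebra.single_mul_single]

theorem mono_zero {n : ℕ} {R : Type*} [CommRing R] : mono R (0 : Fin n → ℤ) = 1 := rfl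

/-- The variable `yⱼ` as a unit of the quotient algebra. -/
def yUnit {n : ℕ} {R : Type*} [CommRing R] (x : Fin n → R) (j : Fin n) : (QuotAlg x)ˣ where
  val := Ideal.Quotient.mk (idealJ x) (mono R (Pi.single j 1))
  inv := Ideal.Quotient.mk (idealJ x) (mono R (Pi.single j (-1)))
  val_inv := by
    rw [← map_mul, ← mono_add, ← Pi.single_add]; simp [mono_zero]
  inv_val := by
    rw [← map_mul, ← mono_add, ← Pi.single_add]; simp [mono_zero]

theorem mk_mono {n : ℕ} {R : Type*} [CommRing R] (x : Fin n → R) (m : Fin n → ℤ) :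
    Ideal.Quotient.mk (idealJ x) (mono R m) = ((∏ j, yUnit x j ^ m j : (QuotAlg x)ˣ) : QuotAlg x) := by
  let F : Multiplicative (Fin n → ℤ) →* QuotAlg x :=
    ((Ideal.Quotient.mk (idealJ x) : Laurent n R →+* QuotAlg x) : Laurent n R →* QuotAlg x).comp
      (AddMonoidAlgebra.of R (Fin n → ℤ))
  let U : Multiplicative (Fin n → ℤ) →* (QuotAlg x)ˣ := F.toHomUnits
  have hU : ∀ m : Fin n → ℤ, ((U (Multiplicative.ofAdd m) : (QuotAlg x)ˣ) : QuotAlg x) =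
      Ideal.Quotient.mk (idealJ x) (mono R m) := fun m => rfl
  have hy : ∀ j, U (Multiplicative.ofAdd (Pi.single j 1)) = yUnit x j := fun j => Units.ext rfl
  rw [← hU]
  congr 1
  have hm : Multiplicative.ofAdd m =
      ∏ j, (Multiplicative.ofAdd (Pi.single j (1 : ℤ) : Fin n → ℤ)) ^ m j := by
    apply Multiplicative.toAdd.injective
    rw [toAdd_prod]
    ext i
    simp [Finset.sum_apply, Pi.single_apply]
  rw [hm, map_prod]
  refine Finset.prod_congr rfl fun j _ => ?_
  rw [map_zpow, hy]

theorem yUnit_rel {n : ℕ} {R : Type*} [CommRing R] (x : Fin n → R) (j : Fin n) :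
    ((yUnit x j : (QuotAlg x)ˣ) : QuotAlg x) + ((yUnit x j)⁻¹ : (QuotAlg x)ˣ) =
      algebraMap R (QuotAlg x) (2 * x j) := by
  have h : Ideal.Quotient.mk (idealJ x)
      (algebraMap R (Laurent n R) (2 * x j) - mono R (Pi.single j 1) -
        mono R (Pi.single j (-1))) = 0 :=
    Ideal.Quotient.eq_zero_iff_mem.2 (Ideal.subset_span ⟨j, rfl⟩)
  rw [map_sub, map_sub, sub_sub, sub_eq_zero] at h
  exact h.symm

/-- In one variable: multiplication by `u^m` acts on `(1, u)` as `B^m`. -/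
theorem block_mul {R T : Type*} [CommRing R] [CommRing T] [Algebra R T] (x : R) (u : Tˣ)
    (hu : (u : T) + ((u⁻¹ : Tˣ) : T) = algebraMap R T (2 * x)) (m : ℤ) (t : Fin 2) :
    ((u ^ m : Tˣ) : T) * (u : T) ^ (t : ℕ) =
      ∑ s : Fin 2, algebraMap R T (((blockB x ^ m : (Matrix (Fin 2) (Fin 2) R)ˣ) :
        Matrix (Fin 2) (Fin 2) R) s t) * (u : T) ^ (s : ℕ) := by
  have huu : (u : T) * ((u⁻¹ : Tˣ) : T) = 1 := u.mul_inv
  induction m using Int.induction_on generalizing t with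
  | zero => fin_cases t <;> simp
  | succ i ih =>
    have h0 := ih 0
    have h1 := ih 1
    rw [zpow_add_one, zpow_add_one]
    simp only [Units.val_mul, Matrix.mul_apply, Fin.sum_univ_two] at h0 h1 ⊢
    generalize ((u ^ (i : ℤ) : Tˣ) : T) = w at h0 h1 ⊢
    generalize ((blockB x ^ (i : ℤ) : (Matrix (Fin 2) (Fin 2) R)ˣ) :
      Matrix (Fin 2) (Fin 2) R) = N at h0 h1 ⊢
    fin_cases t
    · simp [blockB] at h0 h1 ⊢
      linear_combination h1
    · simp [blockB] at h0 h1 hu ⊢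
      linear_combination (-1) * h0 + (algebraMap R T 2 * algebraMap R T x) * h1 +
        w * (u * hu - huu)
  | pred i ih =>
    have h0 := ih 0
    have h1 := ih 1
    rw [zpow_sub_one, zpow_sub_one]
    simp only [Units.val_mul, Matrix.mul_apply, Fin.sum_univ_two] at h0 h1 ⊢
    generalize ((u ^ (-(i : ℤ)) : Tˣ) : T) = w at h0 h1 ⊢
    generalize ((blockB x ^ (-(i : ℤ)) : (Matrix (Fin 2) (Fin 2) R)ˣ) :
      Matrix (Fin 2) (Fin 2) R) = N at h0 h1 ⊢
    fin_cases t
    · simp [blockB] at h0 h1 hu ⊢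
      linear_combination (algebraMap R T 2 * algebraMap R T x) * h0 - h1 +
        w * hu
    · simp [blockB] at h0 h1 ⊢
      linear_combination h0

/-- `[h] [y^t] = ∑ₛ (kronMatrix x h)_{s,t} [y^s]`. -/
theorem mk_mul_monoClass {n : ℕ} {R : Type*} [CommRing R] (x : Fin n → R) (h : Laurent n R)
    (t : Fin n → Fin 2) :
    Ideal.Quotient.mk (idealJ x) h * monoClass x t =
      ∑ s, kronMatrix x h s t • monoClass x s := by
  have hm : ∀ m : Fin n → ℤ, Ideal.Quotient.mk (idealJ x) (mono R m) * monoClass x t =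
      ∑ s, kron x (Multiplicative.ofAdd m) s t • monoClass x s := by
    intro m
    have hc : ∀ s, monoClass x s = ∏ j, ((yUnit x j : (QuotAlg x)ˣ) : QuotAlg x) ^ (s j : ℕ) := by
      intro s
      rw [monoClass, mk_mono]
      simp
    rw [hc, mk_mono, Units.coe_prod, ← Finset.prod_mul_distrib]
    rw [Finset.prod_congr rfl fun j _ =>
      block_mul (x j) (yUnit x j) (yUnit_rel x j) (m j) (t j)]
    rw [Finset.prod_univ_sum, Fintype.piFinset_univ]
    refine Finset.sum_congr rfl fun s _ => ?_
    rw [Finset.prod_mul_distrib, hc, ← map_prod]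
    exact (Algebra.smul_def _ _).symm
  induction h using AddMonoidAlgebra.induction_linear with
  | zero => simp
  | add f g hf hg =>
    simp only [map_add, add_mul, hf, hg, Matrix.add_apply, add_smul, Finset.sum_add_distrib]
  | single m r =>
    have hs : (AddMonoidAlgebra.single m r : Laurent n R) = r • mono R m := by
      simp [mono]
    have h2 : Ideal.Quotient.mk (idealJ x) (r • mono R m) =
      r • Ideal.Quotient.mk (idealJ x) (mono R m) := rfl
    rw [hs, h2, smul_mul_assoc, hm, Finset.smul_sum]
    refine Finset.sum_congr rfl fun s _ => ?_
    rw [smul_smul, map_smul]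
    simp [kronMatrix, mono]

theorem kronMatrix_idealJ {n : ℕ} {R : Type*} [CommRing R] (x : Fin n → R) :
    ∀ h ∈ idealJ x, kronMatrix x h = 0 := by
  have : idealJ x ≤ RingHom.ker (kronMatrix x) := by
    refine Ideal.span_le.2 ?_
    rintro _ ⟨j, rfl⟩
    rw [SetLike.mem_coe, RingHom.mem_ker]
    ext s t
    simp only [map_sub, AlgHom.commutes, mono, kronMatrix, AddMonoidAlgebra.lift_single, one_smul,
      Matrix.sub_apply, Matrix.zero_apply, kron, MonoidHom.coe_mk, OneHom.coe_mk, Matrix.of_apply,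
      toAdd_ofAdd]
    by_cases hst : ∀ i, i ≠ j → s i = t i
    · have key : ∀ a : ℤ, ∏ i, ((blockB (x i) ^ ((Pi.single j a : Fin n → ℤ) i) :
          (Matrix (Fin 2) (Fin 2) R)ˣ) : Matrix (Fin 2) (Fin 2) R) (s i) (t i) =
          ((blockB (x j) ^ a : (Matrix (Fin 2) (Fin 2) R)ˣ) :
            Matrix (Fin 2) (Fin 2) R) (s j) (t j) := by
        intro a
        rw [Finset.prod_eq_single j]
        · simp
        · intro i _ hi
          simp [Pi.single_eq_of_ne hi, hst i hi]
        · simp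
      have hone : (algebraMap R (Matrix (Fin n → Fin 2) (Fin n → Fin 2) R) (2 * x j)) s t =
          if s j = t j then 2 * x j else 0 := by
        rw [Matrix.algebraMap_matrix_apply]
        by_cases h : s j = t j
        · have : s = t := by
            ext i; by_cases hi : i = j
            · subst hi; rw [h]
            · rw [hst i hi]
          simp [this]
        · have : s ≠ t := fun h' => h (by rw [h'])
          simp [this, h]
      rw [key, key, hone]
      generalize s j = p
      generalize t j = q
      fin_cases p <;> fin_cases q <;> simp [blockB]
    · push Not at hst
      obtain ⟨i, hi, hne⟩ := hst
      have key : ∀ a : ℤ, ∏ i, ((blockB (x i) ^ ((Pi.single j a : Fin n → ℤ) i) :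
          (Matrix (Fin 2) (Fin 2) R)ˣ) : Matrix (Fin 2) (Fin 2) R) (s i) (t i) = 0 := by
        intro a
        refine Finset.prod_eq_zero (Finset.mem_univ i) ?_
        simp [Pi.single_eq_of_ne hi, hne]
      have : s ≠ t := fun h' => hne (by rw [h'])
      rw [key, key, Matrix.algebraMap_matrix_apply]
      simp [this]
  exact fun h hh => this hh

theorem kronMatrix_mono_zero {n : ℕ} {R : Type*} [CommRing R] (x : Fin n → R)
    (s t : Fin n → Fin 2) :
    kronMatrix x (mono R fun j => ((s j : ℕ) : ℤ)) t 0 = if t = s then 1 else 0 := by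
  simp only [mono, kronMatrix, AddMonoidAlgebra.lift_single, one_smul, kron, MonoidHom.coe_mk,
    OneHom.coe_mk, Matrix.of_apply, toAdd_ofAdd, zpow_natCast, Pi.zero_apply]
  have key : ∀ j, ((blockB (x j) ^ ((s j : Fin 2) : ℕ) : (Matrix (Fin 2) (Fin 2) R)ˣ) :
      Matrix (Fin 2) (Fin 2) R) (t j) 0 = if t j = s j then 1 else 0 := by
    intro j
    generalize s j = p
    generalize t j = q
    fin_cases p <;> fin_cases q <;> simp [blockB]
  rw [Finset.prod_congr rfl fun j _ => key j]
  by_cases h : t = s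
  · simp [h]
  · obtain ⟨j, hj⟩ := Function.ne_iff.1 h
    rw [if_neg h]
    exact Finset.prod_eq_zero (Finset.mem_univ j) (if_neg hj)

theorem linearIndependent_monoClass {n : ℕ} {R : Type*} [CommRing R] (x : Fin n → R) :
    LinearIndependent R (monoClass x) := by
  rw [Fintype.linearIndependent_iff]
  intro c hc s
  have h1 : Ideal.Quotient.mk (idealJ x)
      (∑ s, c s • mono R fun j => ((s j : ℕ) : ℤ)) = 0 := by
    rw [map_sum, ← hc]
    rfl
  have h2 := kronMatrix_idealJ x _ (Ideal.Quotient.eq_zero_iff_mem.1 h1)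
  have h3 := congrFun (congrFun h2 s) 0
  simpa [map_sum, Matrix.sum_apply, kronMatrix_mono_zero] using h3

theorem span_monoClass {n : ℕ} {R : Type*} [CommRing R] (x : Fin n → R) :
    ⊤ ≤ Submodule.span R (Set.range (monoClass x)) := by
  intro a _
  obtain ⟨h, rfl⟩ := Ideal.Quotient.mk_surjective a
  have h0 : monoClass x (0 : Fin n → Fin 2) = 1 := by
    have : (fun j : Fin n => (((0 : Fin n → Fin 2) j : ℕ) : ℤ)) = 0 := by ext; simp
    rw [monoClass, this, mono_zero, map_one]
  have := mk_mul_monoClass x h 0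
  rw [h0, mul_one] at this
  rw [this]
  exact Submodule.sum_mem _ fun s _ =>
    Submodule.smul_mem _ _ (Submodule.subset_span ⟨s, rfl⟩)

/-- The basis `{[y^s] : s ∈ {0,1}ⁿ}` of the quotient algebra. -/
def stdBasis {n : ℕ} {R : Type*} [CommRing R] (x : Fin n → R) :
    Module.Basis (Fin n → Fin 2) R (QuotAlg x) :=
  Module.Basis.mk (linearIndependent_monoClass x) (span_monoClass x)

theorem kronMatrix_map {n : ℕ} {R S : Type*} [CommRing R] [CommRing S] (f : R →+* S)
    (x : Fin n → R) (h : Laurent n R) :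
    (kronMatrix x h).map f =
      kronMatrix (fun j => f (x j)) (AddMonoidAlgebra.mapRingHom (Fin n → ℤ) f h) := by
  have hB : ∀ (a : R) (m : ℤ),
      ((blockB a ^ m : (Matrix (Fin 2) (Fin 2) R)ˣ) : Matrix (Fin 2) (Fin 2) R).map f =
      ((blockB (f a) ^ m : (Matrix (Fin 2) (Fin 2) S)ˣ) : Matrix (Fin 2) (Fin 2) S) := by
    intro a m
    have h1 : Units.map (f.mapMatrix : Matrix (Fin 2) (Fin 2) R →+* _).toMonoidHom (blockB a) =
        blockB (f a) := by
      ext i j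
      fin_cases i <;> fin_cases j <;> simp [blockB, map_ofNat]
    rw [← h1, ← map_zpow]
    rfl
  induction h using AddMonoidAlgebra.induction_linear with
  | zero => ext; simp
  | add p q hp hq => rw [map_add, map_add, map_add, ← hp, ← hq, Matrix.map_add _ f.map_add]
  | single m r =>
    ext s t
    simp only [kronMatrix, AddMonoidAlgebra.lift_single, AddMonoidAlgebra.mapRingHom_single, kron,
      ← hB, Matrix.map_apply, Matrix.smul_apply, MonoidHom.coe_mk, OneHom.coe_mk, Matrix.of_apply,
      smul_eq_mul, map_mul, map_prod]

/-- The standard matrix represents multiplication by `g` in the basis `{[y^s]}`. -/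
theorem isMultiplicationMatrix_stdMatrix {n : ℕ} (g : Laurent n ℂ) :
    IsMultiplicationMatrix (stdBasis (varK n)) g (stdMatrix g) := by
  rw [IsMultiplicationMatrix, stdMatrix, kronMatrix_map]
  ext s t
  have h : mulMap g (stdBasis (varK n) t) =
      ∑ s, kronMatrix (varK n) (AddMonoidAlgebra.mapRingHom (Fin n → ℤ)
        ((algebraMap (MvPolynomial (Fin n) ℂ) (FieldK n)).comp C) g) s t •
          stdBasis (varK n) s := by
    simp only [stdBasis, Module.Basis.mk_apply]
    exact mk_mul_monoClass (varK n) _ t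
  rw [LinearMap.toMatrix_apply, h, Module.Basis.repr_sum_self, AddMonoidAlgebra.mapRingHom_comp]
  rfl

end Lissajous

end

noncomputable section

namespace Lissajous

/-! Put `xⱼ = (yⱼ + yⱼ⁻¹)/2`. The points `y` over one `x` are the sign flips `yⱼ ↦ yⱼ^{±1}` of any
of them, and for generic `x` the evaluations at these flips diagonalise multiplication by `g`. Hence
`det M_g`, pulled back to Laurent polynomials in `y`, is the norm `∏ g^σ` over all sign vectors `σ`
(`det_kronMatrix`, `cosHom_det_stdMatrix`).

The ideal of the torus part of `Y_{A,β}` is the kernel of the monomial substitution `toricHom` into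
a domain, so its generator `g` is prime. As `ℂˣ` is divisible, the parametrised points are all the
zeros of `g` in the torus (`exists_torusParam_eq`), and the exponential identifies the Lissajous
variety with their image under cosine (`lissajous_eq_range`). So the norm vanishes at `x` exactly
when some point over `x` is a zero of `g`, that is, when `x` lies on the variety.

By the Nullstellensatz `det M_g = c f^e`, and `e` is found by counting factors `g` after pulling
back to `y`. The norm contributes one for each `σ` in `S = {σ : g ∣ g^σ}`. The generic fiber
consists of the flips of a zero of `g` by elements of `S`, where two flips agree only if they differ
at coordinates with `yⱼ = yⱼ⁻¹` (`isDegree_fiberSigns`). If `g` divides no `yⱼ - yⱼ⁻¹`, the degree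
is `|S|`, and differentiating shows that `g` divides the pullback of `f` only once, so `e = |S|`.
Otherwise `g` is `yⱼ ∓ 1` up to a unit and `f` is `xⱼ ∓ 1` up to a constant, which pulls back to a
square; then `2e = |S|`, while flips coincide in pairs, so `|S|` is twice the degree. -/

/-- The variable `yⱼ` as a unit of the Laurent polynomial ring. -/
def yvar {n : ℕ} (R : Type*) [CommRing R] (j : Fin n) : (Laurent n R)ˣ where
  val := mono R (Pi.single j 1)
  inv := mono R (Pi.single j (-1))
  val_inv := by rw [← mono_add, ← Pi.single_add]; simp [mono_zero]
  inv_val := by rw [← mono_add, ← Pi.single_add]; simp [mono_zero]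

/-! ### Laurent polynomials and their evaluation -/

section Basics

variable {n d : ℕ} {R T : Type*} [CommRing R] [CommRing T] [Algebra R T]

theorem evalLaurent_mono (u : Fin n → Tˣ) (m : Fin n → ℤ) :
    evalLaurent u (mono R m) = ((∏ j, u j ^ m j : Tˣ) : T) := by
  simp [evalLaurent, mono, unitMonomial]

theorem single_eq_smul_mono (m : Fin n → ℤ) (r : R) :
    (AddMonoidAlgebra.single m r : Laurent n R) = r • mono R m := by
  simp [mono]

theorem prod_zpow_single {G : Type*} [CommGroup G] (u : Fin n → G) (j : Fin n) (a : ℤ) :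
    ∏ i, u i ^ (Pi.single j a : Fin n → ℤ) i = u j ^ a := by
  rw [Finset.prod_eq_single j]
  · simp
  · intro i _ hi; simp [Pi.single_eq_of_ne hi]
  · simp

theorem map_evalLaurent_yvar (u : Fin n → Tˣ) (j : Fin n) :
    Units.map (evalLaurent (R := R) u : Laurent n R →* T) (yvar R j) = u j := by
  ext
  simp [yvar, evalLaurent_mono, prod_zpow_single]

theorem evalLaurent_yvar (u : Fin n → Tˣ) (j : Fin n) :
    evalLaurent (R := R) u (yvar R j : Laurent n R) = u j :=
  congrArg Units.val (map_evalLaurent_yvar (R := R) u j)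

theorem evalLaurent_yvar_inv (u : Fin n → Tˣ) (j : Fin n) :
    evalLaurent (R := R) u (((yvar R j)⁻¹ : (Laurent n R)ˣ) : Laurent n R) =
      ((u j)⁻¹ : Tˣ) := by
  rw [← map_evalLaurent_yvar (R := R) u j, ← map_inv]; rfl

theorem mono_eq_prod (m : Fin n → ℤ) :
    mono R m = ((∏ j, yvar R j ^ m j : (Laurent n R)ˣ) : Laurent n R) := by
  let U : Multiplicative (Fin n → ℤ) →* (Laurent n R)ˣ :=
    (AddMonoidAlgebra.of R (Fin n → ℤ)).toHomUnits
  have hU : ∀ m, ((U (Multiplicative.ofAdd m) : (Laurent n R)ˣ) : Laurent n R) = mono R m :=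
    fun m => rfl
  have hy : ∀ j, U (Multiplicative.ofAdd (Pi.single j 1)) = yvar R j := fun j => Units.ext rfl
  rw [← hU]
  congr 1
  have hm : Multiplicative.ofAdd m =
      ∏ j, (Multiplicative.ofAdd (Pi.single j (1 : ℤ) : Fin n → ℤ)) ^ m j := by
    apply Multiplicative.toAdd.injective
    rw [toAdd_prod]
    ext i
    simp [Finset.sum_apply, Pi.single_apply]
  rw [hm, map_prod]
  exact Finset.prod_congr rfl fun j _ => by rw [map_zpow, hy]

theorem algHom_ext_yvar {f g : Laurent n R →ₐ[R] T}
    (h : ∀ j, f ((yvar R j : (Laurent n R)ˣ) : Laurent n R) =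
      g ((yvar R j : (Laurent n R)ˣ) : Laurent n R)) : f = g := by
  apply AddMonoidAlgebra.algHom_ext
  · intro m
    change f (mono R m) = g (mono R m)
    have hu : ∀ j, Units.map (f : Laurent n R →* T) (yvar R j) =
        Units.map (g : Laurent n R →* T) (yvar R j) := fun j => Units.ext (h j)
    have key : ∀ F : Laurent n R →ₐ[R] T, F (mono R m) =
        ((∏ j, Units.map (F : Laurent n R →* T) (yvar R j) ^ m j : Tˣ) : T) := by
      intro F
      rw [mono_eq_prod]
      change ((Units.map (F : Laurent n R →* T) _ : Tˣ) : T) = _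
      rw [map_prod]
      simp only [map_zpow]
    rw [key, key]
    simp only [hu]
  · ext

theorem map_evalLaurent {T' : Type*} [CommRing T'] [Algebra R T'] (F : T →ₐ[R] T')
    (u : Fin n → Tˣ) (h : Laurent n R) :
    F (evalLaurent u h) = evalLaurent (fun j => Units.map (F : T →* T') (u j)) h := by
  have : F.comp (evalLaurent (R := R) u) =
      evalLaurent (fun j => Units.map (F : T →* T') (u j)) := by
    apply algHom_ext_yvar
    intro j
    simp [evalLaurent_yvar]
  exact DFunLike.congr_fun this h

theorem evalLaurent_map_algebraMap (u : Fin n → Tˣ) (h : Laurent n R) :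
    evalLaurent (R := T) u (AddMonoidAlgebra.mapRingHom (Fin n → ℤ) (algebraMap R T) h) =
      evalLaurent u h := by
  induction h using AddMonoidAlgebra.induction_linear with
  | zero => simp
  | add p q hp hq => simp only [map_add, hp, hq]
  | single m r =>
    rw [AddMonoidAlgebra.mapRingHom_single, single_eq_smul_mono, single_eq_smul_mono, map_smul,
      map_smul, evalLaurent_mono, evalLaurent_mono, algebraMap_smul]

theorem evalLaurent_polyToLaurent (u : Fin n → Tˣ) (p : MvPolynomial (Fin n) R) :
    evalLaurent u (polyToLaurent p) = aeval (fun j => (u j : T)) p := by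
  have : (evalLaurent (R := R) u).comp polyToLaurent = aeval (fun j => (u j : T)) := by
    ext j
    simp [polyToLaurent, evalLaurent_mono, prod_zpow_single]
  exact DFunLike.congr_fun this p

/-- Clearing denominators. -/
theorem exists_mono_mul_eq_polyToLaurent (h : Laurent n R) :
    ∃ (m : Fin n → ℕ) (p : MvPolynomial (Fin n) R),
      mono R (fun j => (m j : ℤ)) * h = polyToLaurent p := by
  have hmono : ∀ m : Fin n → ℕ, polyToLaurent (∏ j, X j ^ m j) = mono R fun j => (m j : ℤ) := by
    intro m
    rw [mono_eq_prod, map_prod, Units.coe_prod]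
    refine Finset.prod_congr rfl fun j _ => ?_
    rw [map_pow, zpow_natCast, Units.val_pow_eq_pow_val]
    congr 1
    simp [polyToLaurent, yvar]
  induction h using AddMonoidAlgebra.induction_linear with
  | zero => exact ⟨0, 0, by simp⟩
  | add f g hf hg =>
    obtain ⟨m, p, hp⟩ := hf
    obtain ⟨k, q, hq⟩ := hg
    refine ⟨m + k, (∏ j, X j ^ k j) * p + (∏ j, X j ^ m j) * q, ?_⟩
    have : (fun j => (((m + k) j : ℕ) : ℤ)) = (fun j => (m j : ℤ)) + fun j => (k j : ℤ) := by
      ext; simp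
    rw [map_add, map_mul, map_mul, hmono, hmono, ← hp, ← hq, this, mono_add]
    ring
  | single a r =>
    refine ⟨fun j => (a j).natAbs, C r * ∏ j, X j ^ (a j + (a j).natAbs).toNat, ?_⟩
    rw [map_mul, hmono, single_eq_smul_mono, mul_smul_comm, ← mono_add]
    have hC : polyToLaurent (n := n) (C r) = algebraMap R (Laurent n R) r := by
      simp [polyToLaurent]
    rw [hC, ← Algebra.smul_def]
    congr 2
    ext j
    simp only [Pi.add_apply]
    omega

end Basics

/-- Moving a single coordinate from `1` to `2` suffices: powers of `2` are separated by their
absolute values. -/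
theorem prod_zpow_injective {d : ℕ} {m m' : Fin d → ℤ}
    (h : ∀ v : Fin d → ℂˣ, ∏ k, v k ^ m k = ∏ k, v k ^ m' k) : m = m' := by
  ext k
  have h2 := h (Pi.mulSingle k (Units.mk0 2 two_ne_zero))
  have key : ∀ a : Fin d → ℤ,
      ∏ i, (Pi.mulSingle k (Units.mk0 (2 : ℂ) two_ne_zero) : Fin d → ℂˣ) i ^ a i =
        Units.mk0 (2 : ℂ) two_ne_zero ^ a k := by
    intro a
    rw [Finset.prod_eq_single k]
    · simp
    · intro i _ hi; simp [Pi.mulSingle_eq_of_ne hi]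
    · simp
  rw [key, key] at h2
  have h3 := congrArg (fun x : ℂˣ => ‖(x : ℂ)‖) h2
  simp only [Units.val_zpow_eq_zpow_val, Units.val_mk0, norm_zpow, Complex.norm_two] at h3
  exact zpow_right_injective₀ (by norm_num) (by norm_num) h3

/-- A Laurent polynomial which vanishes on the torus is zero. -/
theorem eq_zero_of_evalLaurent_eq_zero {d : ℕ} {h : Laurent d ℂ}
    (hh : ∀ v : Fin d → ℂˣ, evalLaurent v h = 0) : h = 0 := by
  -- Distinct monomials are distinct characters of the torus, so Dedekind independence kills every
  -- coefficient.
  let χ : (Fin d → ℤ) → ((Fin d → ℂˣ) →* ℂ) := fun m =>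
    { toFun := fun v => ((∏ k, v k ^ m k : ℂˣ) : ℂ)
      map_one' := by simp
      map_mul' := fun v w => by simp [mul_zpow, Finset.prod_mul_distrib] }
  have hχ : Function.Injective χ := fun m m' hm => prod_zpow_injective fun v =>
    Units.ext (DFunLike.congr_fun hm v)
  have hli := (linearIndependent_monoidHom (Fin d → ℂˣ) ℂ).comp χ hχ
  have h0 := linearIndependent_iff.1 hli h.coeff (by
    ext v
    have := hh v
    rw [evalLaurent, AddMonoidAlgebra.lift_apply] at this
    rw [Finsupp.linearCombination_apply, Finsupp.sum_apply']
    · simpa [χ, unitMonomial] using this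
    )
  ext m
  simp [h0]

/-- The tuple `(u₁^{σ₁}, …, u_n^{σ_n})` for signs `σⱼ = ±1`. -/
def flip {n : ℕ} {G : Type*} [Group G] (σ : Fin n → ℤˣ) (u : Fin n → G) : Fin n → G :=
  fun j => u j ^ (σ j : ℤ)

theorem flip_flip {n : ℕ} {G : Type*} [Group G] (σ τ : Fin n → ℤˣ) (u : Fin n → G) :
    flip σ (flip τ u) = flip (σ * τ) u := by
  ext j
  simp [flip, ← zpow_mul, mul_comm]

theorem flip_one {n : ℕ} {G : Type*} [Group G] (u : Fin n → G) : flip 1 u = u := by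
  ext j; simp [flip]

theorem map_flip {n : ℕ} {G H : Type*} [Group G] [Group H] (F : G →* H) (σ : Fin n → ℤˣ)
    (u : Fin n → G) : (fun j => F (flip σ u j)) = flip σ fun j => F (u j) := by
  ext j; simp [flip]

theorem flip_injective {n : ℕ} {G : Type*} [Group G] {u : Fin n → G}
    (hu : ∀ j, u j ≠ (u j)⁻¹) : Function.Injective fun σ => flip σ u := by
  intro σ τ h
  ext j : 1
  have hj := congrFun h j
  simp only [flip] at hj
  rcases Int.units_eq_one_or (σ j) with h1 | h1 <;> rcases Int.units_eq_one_or (τ j) with h2 | h2 <;>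
    simp only [h1, h2] at hj ⊢
  · simp at hj; exact absurd hj (hu j)
  · simp at hj; exact absurd hj.symm (hu j)

/-! ### The multiplication determinant as a norm -/

section Det

variable {n : ℕ} {T : Type*} [CommRing T]

/-- Evaluation of classes in the quotient algebra at a solution `u` of `uⱼ + uⱼ⁻¹ = 2xⱼ`. -/
def evalQuot (x : Fin n → T) (u : Fin n → Tˣ)
    (hu : ∀ j, (u j : T) + ((u j)⁻¹ : Tˣ) = 2 * x j) : QuotAlg x →ₐ[T] T :=
  Ideal.Quotient.liftₐ (idealJ x) (evalLaurent u) fun a ha => by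
    have : idealJ x ≤ RingHom.ker (evalLaurent (R := T) u) := by
      refine Ideal.span_le.2 ?_
      rintro _ ⟨j, rfl⟩
      rw [SetLike.mem_coe, RingHom.mem_ker, map_sub, map_sub, AlgHom.commutes, evalLaurent_mono,
        evalLaurent_mono, prod_zpow_single, prod_zpow_single, zpow_one, zpow_neg_one, sub_sub, hu]
      simp
    exact this ha

theorem evalQuot_mk (x : Fin n → T) (u : Fin n → Tˣ)
    (hu : ∀ j, (u j : T) + ((u j)⁻¹ : Tˣ) = 2 * x j) (h : Laurent n T) :
    evalQuot x u hu (Ideal.Quotient.mk (idealJ x) h) = evalLaurent u h := rfl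

theorem flip_add_inv {x : Fin n → T} {u : Fin n → Tˣ}
    (hu : ∀ j, (u j : T) + ((u j)⁻¹ : Tˣ) = 2 * x j) (σ : Fin n → ℤˣ) (j : Fin n) :
    ((flip σ u j : Tˣ) : T) + ((flip σ u j)⁻¹ : Tˣ) = 2 * x j := by
  rw [← hu j]
  rcases Int.units_eq_one_or (σ j) with h | h
  · simp [flip, h]
  · simp [flip, h, add_comm]

/-- The determinant of multiplication by `h` is the product of the values of `h` at all solutions
of `yⱼ + yⱼ⁻¹ = 2xⱼ`. -/
theorem det_kronMatrix [IsDomain T] {x : Fin n → T} {u : Fin n → Tˣ}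
    (hu : ∀ j, (u j : T) + ((u j)⁻¹ : Tˣ) = 2 * x j) (hne : ∀ j, u j ≠ (u j)⁻¹)
    (h : Laurent n T) :
    (kronMatrix x h).det = ∏ σ : Fin n → ℤˣ, evalLaurent (flip σ u) h := by
  -- Any bijection will do; it only makes the evaluation matrix `V` square.
  obtain ⟨E⟩ : Nonempty ((Fin n → Fin 2) ≃ (Fin n → ℤˣ)) :=
    Fintype.card_eq.1 (by simp)
  let ev : (Fin n → ℤˣ) → (QuotAlg x →ₐ[T] T) := fun σ =>
    evalQuot x (flip σ u) (flip_add_inv hu σ)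
  have hev : Function.Injective fun σ => ((ev σ : QuotAlg x →ₐ[T] T) : QuotAlg x →* T) := by
    intro σ τ hστ
    apply flip_injective hne
    ext j
    have := DFunLike.congr_fun hστ (Ideal.Quotient.mk (idealJ x) (yvar T j : (Laurent n T)ˣ))
    simpa [ev, evalQuot_mk, evalLaurent_yvar] using this
  let V : Matrix (Fin n → Fin 2) (Fin n → Fin 2) T := Matrix.of fun τ s => ev (E τ) (monoClass x s)
  -- A relation among the rows of `V` is a linear relation among the distinct multiplicative maps
  -- `ev (E τ)`, which Dedekind's theorem excludes.
  have hV : V.det ≠ 0 := by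
    intro h0
    obtain ⟨c, hc, hc0⟩ := Matrix.exists_vecMul_eq_zero_iff.2 h0
    apply hc
    have hli := (linearIndependent_monoidHom (QuotAlg x) T).comp _ (hev.comp E.injective)
    rw [Fintype.linearIndependent_iff] at hli
    have key : ∑ τ, c τ • (ev (E τ)).toLinearMap = 0 := by
      apply (stdBasis x).ext
      intro s
      have := congrFun hc0 s
      simpa [Matrix.vecMul, dotProduct, V, stdBasis] using this
    funext τ
    refine hli c ?_ τ
    funext a
    have := LinearMap.congr_fun key a
    simpa using this
  -- The rows of `V` are left eigenvectors: this evaluates the class of `h y^t` in two ways.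
  have hmul : V * kronMatrix x h =
      Matrix.diagonal (fun τ => evalLaurent (flip (E τ) u) h) * V := by
    ext τ t
    rw [Matrix.diagonal_mul, Matrix.mul_apply]
    have := congrArg (ev (E τ)) (mk_mul_monoClass x h t)
    rw [map_mul, map_sum] at this
    simp only [map_smul, smul_eq_mul] at this
    simp only [V, Matrix.of_apply]
    rw [show evalLaurent (flip (E τ) u) h = ev (E τ) (Ideal.Quotient.mk (idealJ x) h) from rfl,
      this]
    exact Finset.sum_congr rfl fun s _ => mul_comm _ _
  have hdet := congrArg Matrix.det hmul
  rw [Matrix.det_mul, Matrix.det_mul, Matrix.det_diagonal, mul_comm] at hdet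
  rw [mul_right_cancel₀ hV hdet]
  exact E.prod_comp fun σ => evalLaurent (flip σ u) h

end Det

/-! ### The cosine substitution and sign flips -/

section Cos

variable {n : ℕ}

/-- The substitution `xⱼ = (yⱼ + yⱼ⁻¹)/2`. -/
def cosHom (n : ℕ) : MvPolynomial (Fin n) ℂ →ₐ[ℂ] Laurent n ℂ :=
  aeval fun j => (2⁻¹ : ℂ) • ((yvar ℂ j : (Laurent n ℂ)ˣ) + ((yvar ℂ j)⁻¹ : (Laurent n ℂ)ˣ))

/-- The conjugation `yⱼ ↦ yⱼ^{σⱼ}`. -/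
def conj (σ : Fin n → ℤˣ) : Laurent n ℂ →ₐ[ℂ] Laurent n ℂ := evalLaurent (flip σ (yvar ℂ))

/-- The point `((yⱼ + yⱼ⁻¹)/2)ⱼ`. -/
def cosPoint (y : Fin n → ℂˣ) : Fin n → ℂ := fun j => ((y j : ℂ) + (y j : ℂ)⁻¹) / 2

theorem evalLaurent_cosHom (y : Fin n → ℂˣ) (p : MvPolynomial (Fin n) ℂ) :
    evalLaurent y (cosHom n p) = eval (cosPoint y) p := by
  have : (evalLaurent (R := ℂ) y).comp (cosHom n) = aeval (cosPoint y) := by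
    ext j
    simp only [cosHom, AlgHom.comp_apply, aeval_X, map_smul, map_add, evalLaurent_yvar,
      evalLaurent_yvar_inv, cosPoint, smul_eq_mul, Units.val_inv_eq_inv_val]
    ring
  rw [← coe_aeval_eq_eval]
  exact DFunLike.congr_fun this p

theorem evalLaurent_conj (y : Fin n → ℂˣ) (σ : Fin n → ℤˣ) (h : Laurent n ℂ) :
    evalLaurent y (conj σ h) = evalLaurent (flip σ y) h := by
  rw [conj, map_evalLaurent]
  congr 2
  rw [map_flip]
  simp only [map_evalLaurent_yvar]

theorem two_mul_cosHom_X (j : Fin n) : 2 * cosHom n (X j) =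
    (yvar ℂ j : (Laurent n ℂ)ˣ) + ((yvar ℂ j)⁻¹ : (Laurent n ℂ)ˣ) := by
  rw [cosHom, aeval_X, two_mul, ← add_smul]
  norm_num

theorem yvar_ne_inv (j : Fin n) : yvar ℂ j ≠ (yvar ℂ j)⁻¹ := by
  intro h
  have h1 := congrArg (Units.map (evalLaurent (R := ℂ) (fun _ : Fin n => Units.mk0 (2 : ℂ)
    two_ne_zero) : Laurent n ℂ →* ℂ)) h
  rw [map_inv, map_evalLaurent_yvar] at h1
  have h2 := congrArg Units.val h1
  norm_num at h2

/-- After the substitution the variables `yⱼ` themselves solve `uⱼ + uⱼ⁻¹ = 2xⱼ`, so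
`det_kronMatrix` applies over the Laurent ring. -/
theorem cosHom_det_stdMatrix (g : Laurent n ℂ) :
    cosHom n (stdMatrix g).det = ∏ σ : Fin n → ℤˣ, conj σ g := by
  rw [AlgHom.map_det]
  have h1 : (cosHom n).mapMatrix (stdMatrix g) = kronMatrix (fun j => cosHom n (X j))
      (AddMonoidAlgebra.mapRingHom (Fin n → ℤ) (algebraMap ℂ (Laurent n ℂ)) g) := by
    have := kronMatrix_map (cosHom n : MvPolynomial (Fin n) ℂ →+* Laurent n ℂ) (fun j => X j)
      (AddMonoidAlgebra.mapRingHom (Fin n → ℤ) C g)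
    rw [← RingHom.comp_apply, ← AddMonoidAlgebra.mapRingHom_comp] at this
    refine this.trans ?_
    congr 2
    congr 1
    ext r : 1
    exact (cosHom n).commutes r
  rw [h1, det_kronMatrix (u := yvar ℂ) _ yvar_ne_inv]
  · exact Finset.prod_congr rfl fun σ _ => evalLaurent_map_algebraMap _ _
  · exact fun j => (two_mul_cosHom_X j).symm

theorem eval_det_stdMatrix (g : Laurent n ℂ) (y : Fin n → ℂˣ) :
    eval (cosPoint y) (stdMatrix g).det = ∏ σ : Fin n → ℤˣ, evalLaurent (flip σ y) g := by
  rw [← evalLaurent_cosHom, cosHom_det_stdMatrix, map_prod]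
  simp only [evalLaurent_conj]

theorem conj_conj (σ τ : Fin n → ℤˣ) (h : Laurent n ℂ) : conj σ (conj τ h) = conj (σ * τ) h := by
  rw [← sub_eq_zero]
  apply eq_zero_of_evalLaurent_eq_zero
  intro v
  rw [map_sub, evalLaurent_conj, evalLaurent_conj, evalLaurent_conj, flip_flip, mul_comm, sub_self]

theorem conj_one (h : Laurent n ℂ) : conj 1 h = h := by
  rw [← sub_eq_zero]
  apply eq_zero_of_evalLaurent_eq_zero
  intro v
  rw [map_sub, evalLaurent_conj, flip_one, sub_self]

/-- Two points over the same point of `ℂⁿ` are conjugate. -/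
theorem exists_flip_of_cosPoint_eq {y z : Fin n → ℂˣ} (h : cosPoint y = cosPoint z) :
    ∃ σ : Fin n → ℤˣ, y = flip σ z := by
  have hj : ∀ j, ∃ s : ℤˣ, y j = z j ^ (s : ℤ) := by
    intro j
    have h1 := congrFun h j
    simp only [cosPoint] at h1
    have hy := (y j).ne_zero
    have hz := (z j).ne_zero
    -- The equation `y + y⁻¹ = z + z⁻¹` factors, forcing `y = z` or `y = z⁻¹`.
    have h2 : ((y j : ℂ) - z j) * ((y j : ℂ) * z j - 1) = 0 := by
      field_simp at h1
      linear_combination h1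
    rcases mul_eq_zero.1 h2 with h3 | h3
    · exact ⟨1, by ext; simpa using sub_eq_zero.1 h3⟩
    · refine ⟨-1, ?_⟩
      have : y j * z j = 1 := Units.ext (by simpa using sub_eq_zero.1 h3)
      simpa using eq_inv_of_mul_eq_one_left this
  choose σ hσ using hj
  exact ⟨σ, funext hσ⟩

theorem cosPoint_flip (σ : Fin n → ℤˣ) (y : Fin n → ℂˣ) : cosPoint (flip σ y) = cosPoint y := by
  ext j
  rcases Int.units_eq_one_or (σ j) with h | h
  · simp [cosPoint, flip, h]
  · simp [cosPoint, flip, h, add_comm]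

theorem exists_cosPoint_eq (x : Fin n → ℂ) : ∃ y : Fin n → ℂˣ, cosPoint y = x := by
  have hj : ∀ j, ∃ u : ℂˣ, ((u : ℂ) + (u : ℂ)⁻¹) / 2 = x j := by
    intro j
    -- The roots `x ± s` of `T² - 2xT + 1` are inverse to each other.
    obtain ⟨s, hs⟩ := IsAlgClosed.exists_pow_nat_eq (x j ^ 2 - 1) two_pos
    have h1 : (x j + s) * (x j - s) = 1 := by linear_combination -hs
    refine ⟨Units.mk0 (x j + s) (left_ne_zero_of_mul_eq_one h1), ?_⟩
    rw [Units.val_mk0, inv_eq_of_mul_eq_one_right h1]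
    ring
  choose y hy using hj
  exact ⟨y, funext hy⟩

end Cos

theorem zpow_sum_eq_prod {G κ : Type*} [CommGroup G] (a : G) (s : Finset κ) (f : κ → ℤ) :
    a ^ (∑ i ∈ s, f i) = ∏ i ∈ s, a ^ f i := by
  classical
  induction s using Finset.induction_on with
  | empty => simp
  | insert i s hi ih => rw [Finset.sum_insert hi, Finset.prod_insert hi, zpow_add, ih]

/-! ### The toric ideal and the torus part of the toric variety -/

section Toric

variable {d n : ℕ} (A : Matrix (Fin d) (Fin n) ℤ) (B : Fin n → ℂˣ)

/-- The parametrization `v ↦ (Bⱼ v^{aⱼ})ⱼ` of the torus part of the scaled toric variety. -/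
def torusParam (v : Fin d → ℂˣ) : Fin n → ℂˣ := fun j => B j * ∏ k, v k ^ A k j

/-- The substitution `yⱼ = Bⱼ v^{aⱼ}`. -/
def toricHom : Laurent n ℂ →ₐ[ℂ] Laurent d ℂ :=
  evalLaurent fun j =>
    Units.map (algebraMap ℂ (Laurent d ℂ) : ℂ →* Laurent d ℂ) (B j) * ∏ k, yvar ℂ k ^ A k j

theorem evalLaurent_toricHom (v : Fin d → ℂˣ) (h : Laurent n ℂ) :
    evalLaurent v (toricHom A B h) = evalLaurent (torusParam A B v) h := by
  rw [toricHom, map_evalLaurent]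
  congr 2
  funext j
  rw [map_mul, map_prod]
  simp only [map_zpow, map_evalLaurent_yvar, torusParam]
  congr 1
  ext
  exact (evalLaurent (R := ℂ) v).commutes _

theorem toricHom_eq_zero_iff {h : Laurent n ℂ} :
    toricHom A B h = 0 ↔ ∀ v, evalLaurent (torusParam A B v) h = 0 := by
  simp only [← evalLaurent_toricHom]
  exact ⟨fun h0 v => by rw [h0, map_zero], eq_zero_of_evalLaurent_eq_zero⟩

theorem prod_torusParam_zpow (v : Fin d → ℂˣ) (m : Fin n → ℤ) :
    ∏ j, torusParam A B v j ^ m j = (∏ j, B j ^ m j) * ∏ k, v k ^ (A.mulVec m k) := by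
  have : ∀ k, v k ^ (A.mulVec m k) = ∏ j, (v k ^ A k j) ^ m j := by
    intro k
    simp only [Matrix.mulVec, dotProduct, ← zpow_mul, zpow_sum_eq_prod]
  simp only [torusParam, mul_zpow, Finset.prod_mul_distrib, this]
  rw [Finset.prod_comm]
  congr 1
  exact Finset.prod_congr rfl fun j _ => (Finset.prod_zpow _ _ _).symm

/-- These lattice binomials serve twice: they cut out the parametrised points in the torus, and one
with `m ≠ 0` shows that the ideal is nonzero. -/
theorem toricHom_mono_sub {m : Fin n → ℤ} (hm : A.mulVec m = 0) :
    toricHom A B (mono ℂ m - algebraMap ℂ _ ((∏ j, B j ^ m j : ℂˣ) : ℂ)) = 0 := by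
  rw [toricHom_eq_zero_iff]
  intro v
  rw [map_sub, evalLaurent_mono, prod_torusParam_zpow, hm, AlgHom.commutes]
  simp

theorem mem_toric_of_torusParam (v : Fin d → ℂˣ) :
    (fun j => (torusParam A B v j : ℂ)) ∈ scaledToricVariety A fun j => (B j : ℂ) := by
  refine ⟨fun j => ((∏ k, v k ^ A k j : ℂˣ) : ℂ), ?_, ?_⟩
  · exact zeroLocus_vanishingIdeal_le _ ⟨v, rfl⟩
  · ext j; simp [torusParam]

/-- The closure is taken before scaling, so `p` is first pulled back along `Xⱼ ↦ Bⱼ Xⱼ` to an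
element of the vanishing ideal of the unscaled parametrisation. -/
theorem aeval_eq_zero_of_mem_toric {y : Fin n → ℂ}
    (hy : y ∈ scaledToricVariety A fun j => (B j : ℂ)) {p : MvPolynomial (Fin n) ℂ}
    (hp : toricHom A B (polyToLaurent p) = 0) : aeval y p = 0 := by
  obtain ⟨z, hz, rfl⟩ := hy
  have key : ∀ z : Fin n → ℂ, aeval z (aeval (fun j => C (B j : ℂ) * X j) p) =
      aeval (fun j => (B j : ℂ) * z j) p := by
    intro z
    rw [← AlgHom.comp_apply]
    congr 1
    ext j
    simp
  rw [← key]
  refine hz _ ?_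
  rw [mem_vanishingIdeal_iff]
  rintro _ ⟨v, rfl⟩
  rw [key]
  have := (toricHom_eq_zero_iff A B).1 hp v
  rw [evalLaurent_polyToLaurent] at this
  rw [← this]
  congr 2

theorem evalLaurent_eq_zero_of_mem_toric {y : Fin n → ℂˣ}
    (hy : (fun j => (y j : ℂ)) ∈ scaledToricVariety A fun j => (B j : ℂ)) {h : Laurent n ℂ}
    (hh : toricHom A B h = 0) : evalLaurent y h = 0 := by
  obtain ⟨m, p, hp⟩ := exists_mono_mul_eq_polyToLaurent h
  have h1 := aeval_eq_zero_of_mem_toric A B hy (p := p) (by rw [← hp, map_mul, hh, mul_zero])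
  rw [← evalLaurent_polyToLaurent, ← hp, map_mul, evalLaurent_mono] at h1
  exact (Units.mul_right_eq_zero _).1 h1

theorem torusIdeal_eq_ker : torusIdeal A (fun j => (B j : ℂ)) = RingHom.ker (toricHom A B) := by
  apply le_antisymm
  · intro h hh
    simp only [torusIdeal, Ideal.mem_iInf] at hh
    exact (toricHom_eq_zero_iff A B).2 fun v => hh _ (mem_toric_of_torusParam A B v)
  · intro h hh
    simp only [torusIdeal, Ideal.mem_iInf]
    exact fun y hy => evalLaurent_eq_zero_of_mem_toric A B hy hh

/-- A generator of the toric ideal generates the ideal of the torus part. -/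
theorem ker_toricHom_eq_span {g : Laurent n ℂ}
    (hg : GeneratesToricIdeal A (fun j => (B j : ℂ)) g) :
    RingHom.ker (toricHom A B) = Ideal.span {g} := by
  rcases hg with ⟨p, rfl, hp⟩ | hg
  · have hmem : ∀ q, q ∈ vanishingIdeal ℂ (scaledToricVariety A fun j => (B j : ℂ)) ↔
        toricHom A B (polyToLaurent q) = 0 := by
      intro q
      rw [mem_vanishingIdeal_iff]
      constructor
      · intro h
        rw [toricHom_eq_zero_iff]
        intro v
        rw [evalLaurent_polyToLaurent]
        exact h _ (mem_toric_of_torusParam A B v)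
      · exact fun h y hy => aeval_eq_zero_of_mem_toric A B hy h
    apply le_antisymm
    · intro h hh
      obtain ⟨m, q, hq⟩ := exists_mono_mul_eq_polyToLaurent h
      have h1 : q ∈ Ideal.span {p} := by
        rw [← hp, hmem, ← hq, map_mul, (RingHom.mem_ker).1 hh, mul_zero]
      obtain ⟨r, rfl⟩ := Ideal.mem_span_singleton.1 h1
      rw [mono_eq_prod, map_mul] at hq
      rw [Ideal.mem_span_singleton]
      exact Units.dvd_mul_left.1 (Dvd.intro _ hq.symm)
    · rw [Ideal.span_le, Set.singleton_subset_iff]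
      exact (hmem p).1 (hp ▸ Ideal.mem_span_singleton_self p)
  · rw [← hg, torusIdeal_eq_ker]

/-- The torus part of the scaled toric variety is closed in the torus. -/
theorem exists_torusParam_eq {y : Fin n → ℂˣ}
    (hy : ∀ m : Fin n → ℤ, A.mulVec m = 0 → ∏ j, y j ^ m j = ∏ j, B j ^ m j) :
    ∃ v, y = torusParam A B v := by
  -- Roots come from dividing a logarithm by `k`. A divisible abelian group is injective, which
  -- permits the extension of characters below.
  let _ : DivisibleBy (Additive ℂˣ) ℤ := by
    apply divisibleByOfSMulRightSurj
    intro k hk a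
    obtain ⟨z, hz⟩ : ∃ z : ℂ, Complex.exp z = (a.toMul : ℂˣ) :=
      ⟨_, Complex.exp_log (a.toMul : ℂˣ).ne_zero⟩
    refine ⟨Additive.ofMul (Units.mk0 (Complex.exp (z / k)) (Complex.exp_ne_zero _)), ?_⟩
    apply Additive.toMul.injective
    ext
    rw [← hz]
    have hk' : (k : ℂ) ≠ 0 := by exact_mod_cast hk
    simp only [toMul_zsmul, toMul_ofMul, Units.val_zpow_eq_zpow_val, Units.val_mk0]
    rw [← Complex.exp_int_mul, mul_div_cancel₀ _ hk']
  -- The character `m ↦ (y/B)^m` is trivial on `ker A`, so it factors through the image of `A` in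
  -- `ℤᵈ` and extends to a character `θ` of `ℤᵈ`. The values of `θ` on the unit vectors are the
  -- parameters `v`.
  let χ : (Fin n → ℤ) →+ Additive ℂˣ :=
    { toFun := fun m => Additive.ofMul (∏ j, (y j / B j) ^ m j)
      map_zero' := by simp
      map_add' := fun a b => by simp [zpow_add, Finset.prod_mul_distrib] }
  let F : (Fin n → ℤ) →+ (Fin d → ℤ) := A.mulVecLin.toAddMonoidHom
  have hχ : F.ker ≤ χ.ker := by
    intro m hm
    have hm' : A.mulVec m = 0 := hm
    change Additive.ofMul (∏ j, (y j / B j) ^ m j) = 0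
    simp only [div_zpow, Finset.prod_div_distrib, hy m hm', div_self']
    rfl
  obtain ⟨θ, hθ⟩ := (Module.Baer.of_divisible (Additive ℂˣ)).extension_property_addMonoidHom
    (QuotientAddGroup.kerLift F) (QuotientAddGroup.kerLift_injective F)
    (QuotientAddGroup.lift F.ker χ hχ)
  have hθF : ∀ m, θ (F m) = χ m := fun m => DFunLike.congr_fun hθ (m : (Fin n → ℤ) ⧸ F.ker)
  refine ⟨fun k => (θ (Pi.single k 1)).toMul, ?_⟩
  funext j
  have h1 := hθF (Pi.single j 1)
  have h2 : χ (Pi.single j 1) = Additive.ofMul (y j / B j) := by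
    change Additive.ofMul (∏ i, (y i / B i) ^ (Pi.single j (1 : ℤ) : Fin n → ℤ) i) = _
    rw [prod_zpow_single (fun i => y i / B i), zpow_one]
  have h3 : F (Pi.single j 1) = ∑ k, A k j • (Pi.single k 1 : Fin d → ℤ) := by
    change A.mulVec (Pi.single j 1) = _
    ext k
    simp [Finset.sum_apply, Pi.single_apply]
  rw [h2, h3, map_sum] at h1
  simp only [map_zsmul] at h1
  have h4 := congrArg Additive.toMul h1
  rw [toMul_sum] at h4
  simp only [toMul_zsmul, toMul_ofMul] at h4
  rw [torusParam, h4, mul_div_cancel]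

theorem exists_torusParam_eq_of_vanish {y : Fin n → ℂˣ}
    (hy : ∀ h, toricHom A B h = 0 → evalLaurent y h = 0) : ∃ v, y = torusParam A B v := by
  apply exists_torusParam_eq
  intro m hm
  have := hy _ (toricHom_mono_sub A B hm)
  rw [map_sub, evalLaurent_mono, AlgHom.commutes, sub_eq_zero] at this
  exact Units.ext this

theorem mem_toric_iff_of_span {g : Laurent n ℂ} (hg : RingHom.ker (toricHom A B) = Ideal.span {g})
    (y : Fin n → ℂˣ) :
    (fun j => (y j : ℂ)) ∈ scaledToricVariety A (fun j => (B j : ℂ)) ↔ evalLaurent y g = 0 := by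
  have hg0 : toricHom A B g = 0 := by
    rw [← RingHom.mem_ker, hg]; exact Ideal.mem_span_singleton_self g
  constructor
  · exact fun h => evalLaurent_eq_zero_of_mem_toric A B h hg0
  · intro h
    obtain ⟨v, rfl⟩ := exists_torusParam_eq_of_vanish A B (y := y) fun p hp => by
      rw [← RingHom.mem_ker, hg, Ideal.mem_span_singleton] at hp
      obtain ⟨q, rfl⟩ := hp
      rw [map_mul, h, zero_mul]
    exact mem_toric_of_torusParam A B v

/-- Without an integral kernel vector the columns would be independent over `ℤ`, hence over `ℚ`, and
the rank would be `n`. -/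
theorem exists_mulVec_eq_zero (hA : (A.map (Int.cast : ℤ → ℚ)).rank < n) :
    ∃ m : Fin n → ℤ, m ≠ 0 ∧ A.mulVec m = 0 := by
  by_contra! hno
  have hli : LinearIndependent ℤ (A.map (Int.cast : ℤ → ℚ)).transpose.row := by
    rw [Fintype.linearIndependent_iff]
    intro m hm
    by_contra! hne
    refine hno m (fun h0 => ?_) ?_
    · obtain ⟨i, hi⟩ := hne
      exact hi (congrFun h0 i)
    · ext k
      have := congrFun hm k
      have h1 : ∑ j, (m j : ℚ) * (A k j : ℚ) = 0 := by
        simpa [Finset.sum_apply, Matrix.row] using this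
      have h2 : ∑ j, m j * A k j = 0 := by exact_mod_cast h1
      simpa [Matrix.mulVec, dotProduct, mul_comm] using h2
  rw [LinearIndependent.iff_fractionRing (R := ℤ) (K := ℚ)] at hli
  have := hli.rank_matrix
  rw [Matrix.rank_transpose, Fintype.card_fin] at this
  omega

theorem generator_ne_zero (hA : (A.map (Int.cast : ℤ → ℚ)).rank < n) {g : Laurent n ℂ}
    (hg : RingHom.ker (toricHom A B) = Ideal.span {g}) : g ≠ 0 := by
  rintro rfl
  obtain ⟨m, hm, hAm⟩ := exists_mulVec_eq_zero A hA
  have h1 := toricHom_mono_sub A B hAm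
  rw [← RingHom.mem_ker, hg, Ideal.mem_span_singleton, zero_dvd_iff] at h1
  have h2 := congrArg (fun h : Laurent n ℂ => h.coeff m) h1
  simp [mono, hm.symm] at h2

theorem prime_generator (hA : (A.map (Int.cast : ℤ → ℚ)).rank < n) {g : Laurent n ℂ}
    (hg : RingHom.ker (toricHom A B) = Ideal.span {g}) : Prime g := by
  rw [← Ideal.span_singleton_prime (generator_ne_zero A B hA hg), ← hg]
  exact RingHom.ker_isPrime _

end Toric

/-! ### The Lissajous variety as a cosine image and as a zero set -/

section Lissa

variable {d n : ℕ} (A : Matrix (Fin d) (Fin n) ℤ) (b : Fin n → ℂ)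

/-- `βⱼ` as a unit. -/
def betaUnit (j : Fin n) : ℂˣ := Units.mk0 (beta b j) (Complex.exp_ne_zero _)

/-- Coefficients `z` of a row combination correspond to parameters `v = exp(iz)`, and every nonzero
complex number is such an exponential. The choice of logarithm is harmless because the exponents `A
k j` are integers. -/
theorem lissajous_eq_range :
    lissajous A b = Set.range fun v => cosPoint (torusParam A (betaUnit b) v) := by
  have key : ∀ (z : Fin d → ℂ) (v : Fin d → ℂˣ), (∀ k, (v k : ℂ) = Complex.exp (z k * Complex.I)) →
      ∀ j, Complex.cos ((∑ k, z k • fun j => (A k j : ℂ)) j - b j * (Real.pi : ℂ) / 2) =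
        cosPoint (torusParam A (betaUnit b) v) j := by
    intro z v hv j
    have h1 : (torusParam A (betaUnit b) v j : ℂ) = Complex.exp
        (((∑ k, z k • fun j => (A k j : ℂ)) j - b j * (Real.pi : ℂ) / 2) * Complex.I) := by
      simp only [torusParam, Units.val_mul, Units.coe_prod, Units.val_zpow_eq_zpow_val, hv,
        ← Complex.exp_int_mul, ← Complex.exp_sum, betaUnit, Units.val_mk0, beta, ← Complex.exp_add]
      congr 1
      simp only [Finset.sum_apply, Pi.smul_apply, smul_eq_mul, sub_mul, Finset.sum_mul]
      rw [add_comm, sub_eq_add_neg]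
      congr 1
      · exact Finset.sum_congr rfl fun k _ => by ring
      · ring
    rw [cosPoint, h1, ← Complex.exp_neg, ← neg_mul]
    rfl
  ext x
  constructor
  · rintro ⟨w, hw, hx⟩
    obtain ⟨z, rfl⟩ := (Submodule.mem_span_range_iff_exists_fun ℂ).1 hw
    refine ⟨fun k => Units.mk0 (Complex.exp (z k * Complex.I)) (Complex.exp_ne_zero _), ?_⟩
    funext j
    rw [hx, key z (fun k => Units.mk0 (Complex.exp (z k * Complex.I)) (Complex.exp_ne_zero _))
      fun k => rfl]
  · rintro ⟨v, rfl⟩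
    refine ⟨∑ k, (Complex.log (v k) / Complex.I) • fun j => (A k j : ℂ),
      (Submodule.mem_span_range_iff_exists_fun ℂ).2 ⟨_, rfl⟩, fun j => ?_⟩
    exact (key (fun k => Complex.log (v k) / Complex.I) v (fun k => by
      rw [div_mul_cancel₀ _ Complex.I_ne_zero, Complex.exp_log (v k).ne_zero]) j).symm

theorem mem_vanishingIdeal_lissajous_iff {p : MvPolynomial (Fin n) ℂ} :
    p ∈ vanishingIdeal ℂ (lissajous A b) ↔ toricHom A (betaUnit b) (cosHom n p) = 0 := by
  rw [toricHom_eq_zero_iff, mem_vanishingIdeal_iff, lissajous_eq_range]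
  simp only [evalLaurent_cosHom, Set.forall_mem_range, aeval_eq_eval]

/-- The norm vanishes at `cosPoint y` iff `g` vanishes at some flip of `y`. Such a flip is a
parametrised point and has the same image. -/
theorem lissajous_eq_zeroLocus_det {g : Laurent n ℂ}
    (hg : RingHom.ker (toricHom A (betaUnit b)) = Ideal.span {g}) :
    lissajous A b = {x | eval x (stdMatrix g).det = 0} := by
  have hg0 : toricHom A (betaUnit b) g = 0 := by
    rw [← RingHom.mem_ker, hg]; exact Ideal.mem_span_singleton_self g
  rw [lissajous_eq_range]
  ext x
  constructor
  · rintro ⟨v, rfl⟩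
    rw [Set.mem_ofPred_eq, eval_det_stdMatrix]
    refine Finset.prod_eq_zero (Finset.mem_univ 1) ?_
    rw [flip_one]
    exact (toricHom_eq_zero_iff _ _).1 hg0 v
  · intro hx
    obtain ⟨y, rfl⟩ := exists_cosPoint_eq x
    rw [Set.mem_ofPred_eq, eval_det_stdMatrix, Finset.prod_eq_zero_iff] at hx
    obtain ⟨σ, -, hσ⟩ := hx
    obtain ⟨v, hv⟩ := exists_torusParam_eq_of_vanish A (betaUnit b) (y := flip σ y) fun p hp => by
      rw [← RingHom.mem_ker, hg, Ideal.mem_span_singleton] at hp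
      obtain ⟨q, rfl⟩ := hp
      rw [map_mul, hσ, zero_mul]
    exact ⟨v, by rw [← cosPoint_flip σ y, hv]⟩

/-- Both map to the basis-free determinant of `mulMap g`, and `ℂ[x]` embeds in `K`. -/
theorem det_eq_det_stdMatrix {g : Laurent n ℂ} {ι : Type*} [Fintype ι] [DecidableEq ι]
    (e : Module.Basis ι (FieldK n) (AlgA n)) {M : Matrix ι ι (MvPolynomial (Fin n) ℂ)}
    (hM : IsMultiplicationMatrix e g M) : M.det = (stdMatrix g).det := by
  have hinj : Function.Injective (algebraMap (MvPolynomial (Fin n) ℂ) (FieldK n)) := by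
    rw [IsScalarTower.algebraMap_eq (MvPolynomial (Fin n) ℂ)
      (FractionRing (MvPolynomial (Fin n) ℂ)) (FieldK n)]
    exact (algebraMap (FractionRing (MvPolynomial (Fin n) ℂ)) (FieldK n)).injective.comp
      (IsFractionRing.injective _ _)
  apply hinj
  have key : ∀ {κ : Type _} [Fintype κ] [DecidableEq κ] (e : Module.Basis κ (FieldK n) (AlgA n))
      {M : Matrix κ κ (MvPolynomial (Fin n) ℂ)}, IsMultiplicationMatrix e g M →
      algebraMap (MvPolynomial (Fin n) ℂ) (FieldK n) M.det = LinearMap.det (mulMap g) := by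
    intro κ _ _ e M hM
    rw [← LinearMap.det_toMatrix e, ← hM, RingHom.map_det]
    rfl
  rw [key e hM, ← LinearMap.det_toMatrix (stdBasis (varK n)),
    ← isMultiplicationMatrix_stdMatrix, RingHom.map_det]
  rfl

end Lissa

/-! ### Generic fibers and the degree -/

section Degree

variable {d n : ℕ}

theorem isIntegral_cosHom : (cosHom n : MvPolynomial (Fin n) ℂ →+* Laurent n ℂ).IsIntegral := by
  let _ : Algebra (MvPolynomial (Fin n) ℂ) (Laurent n ℂ) :=
    (cosHom n : MvPolynomial (Fin n) ℂ →+* Laurent n ℂ).toAlgebra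
  have hy : ∀ (j : Fin n) (u : (Laurent n ℂ)ˣ), u = yvar ℂ j ∨ u = (yvar ℂ j)⁻¹ →
      (u : Laurent n ℂ) ∈ integralClosure (MvPolynomial (Fin n) ℂ) (Laurent n ℂ) := by
    intro j u hu
    -- Both `yⱼ` and `yⱼ⁻¹` are roots of `T² - 2xⱼT + 1`.
    refine ⟨Polynomial.X ^ 2 - (Polynomial.C (2 * X j) * Polynomial.X - 1), ?_, ?_⟩
    · apply Polynomial.monic_X_pow_sub
      compute_degree!
    · have h1 : (u : Laurent n ℂ) + ((u⁻¹ : (Laurent n ℂ)ˣ) : Laurent n ℂ) =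
          2 * cosHom n (X j) := by
        rw [two_mul_cosHom_X]
        rcases hu with rfl | rfl
        · rfl
        · rw [inv_inv, add_comm]
      have h2 : algebraMap (MvPolynomial (Fin n) ℂ) (Laurent n ℂ) (2 * X j) =
          2 * cosHom n (X j) := by
        change cosHom n (2 * X j) = _
        rw [map_mul, map_ofNat]
      simp only [Polynomial.eval₂_sub, Polynomial.eval₂_pow, Polynomial.eval₂_X,
        Polynomial.eval₂_mul, Polynomial.eval₂_C, Polynomial.eval₂_one, h2, ← h1]
      linear_combination -(Units.mul_inv u)
  intro h
  change h ∈ integralClosure (MvPolynomial (Fin n) ℂ) (Laurent n ℂ)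
  induction h using AddMonoidAlgebra.induction_linear with
  | zero => exact zero_mem _
  | add p q hp hq => exact add_mem hp hq
  | single m r =>
    rw [single_eq_smul_mono, Algebra.smul_def]
    refine mul_mem ?_ ?_
    · have : algebraMap ℂ (Laurent n ℂ) r =
          algebraMap (MvPolynomial (Fin n) ℂ) (Laurent n ℂ) (C r) :=
        ((cosHom n).commutes r).symm
      rw [this]
      exact Subalgebra.algebraMap_mem _ _
    · rw [mono_eq_prod, Units.coe_prod]
      refine prod_mem fun j _ => ?_
      obtain ⟨k, hk | hk⟩ := Int.eq_nat_or_neg (m j)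
      · rw [hk, zpow_natCast, Units.val_pow_eq_pow_val]
        exact pow_mem (hy j _ (Or.inl rfl)) k
      · rw [hk, zpow_neg, zpow_natCast, ← inv_pow, Units.val_pow_eq_pow_val]
        exact pow_mem (hy j _ (Or.inr rfl)) k

/-- A Laurent polynomial outside a prime ideal has a multiple modulo this ideal which comes from
`ℂ[x]` and lies outside the ideal. -/
theorem exists_cosHom_sub_mem (I : Ideal (Laurent n ℂ)) [I.IsPrime] {q : Laurent n ℂ}
    (hq : q ∉ I) : ∃ p : MvPolynomial (Fin n) ℂ, ∃ r : Laurent n ℂ,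
      cosHom n p ∉ I ∧ cosHom n p - q * r ∈ I := by
  let F : MvPolynomial (Fin n) ℂ →+* Laurent n ℂ ⧸ I :=
    (Ideal.Quotient.mk I).comp (cosHom n : MvPolynomial (Fin n) ℂ →+* Laurent n ℂ)
  have hF : F.IsIntegral :=
    RingHom.IsIntegral.trans _ _ isIntegral_cosHom
      (RingHom.isIntegral_of_surjective _ Ideal.Quotient.mk_surjective)
  have hF' : F.range.subtype.IsIntegral :=
    RingHom.IsIntegral.tower_top F.rangeRestrict F.range.subtype hF
  -- In an integral extension of domains a nonzero ideal contracts to a nonzero ideal; here the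
  -- ideal generated by `q` is contracted to the image of `ℂ[x]`.
  have h1 := Ideal.comap_ne_bot_of_integral_mem (R := F.range)
    (I := Ideal.span {Ideal.Quotient.mk I q}) (x := Ideal.Quotient.mk I q)
    (fun h => hq (Ideal.Quotient.eq_zero_iff_mem.1 h)) (Ideal.mem_span_singleton_self _)
    (hF' (Ideal.Quotient.mk I q))
  obtain ⟨⟨a, p, rfl⟩, ha, ha0⟩ := Submodule.exists_mem_ne_zero_of_ne_bot h1
  rw [Ideal.mem_comap, Ideal.mem_span_singleton] at ha
  obtain ⟨r, hr⟩ := ha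
  obtain ⟨r, rfl⟩ := Ideal.Quotient.mk_surjective r
  refine ⟨p, r, fun hp => ha0 (Subtype.ext (Ideal.Quotient.eq_zero_iff_mem.2 hp)), ?_⟩
  rw [← Ideal.Quotient.eq_zero_iff_mem, map_sub, map_mul, sub_eq_zero]
  exact hr

open Classical in
/-- The signs `σ` for which the conjugate `g^σ` is a multiple of `g`. -/
def stabSigns (g : Laurent n ℂ) : Finset (Fin n → ℤˣ) :=
  Finset.univ.filter fun σ => g ∣ conj σ g

open Classical in
/-- The elements of `stabSigns g` which are trivial at all `j` with `yⱼ = yⱼ⁻¹` modulo `g`. -/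
def fiberSigns (g : Laurent n ℂ) : Finset (Fin n → ℤˣ) :=
  (stabSigns g).filter fun σ =>
    ∀ j, g ∣ ((yvar ℂ j : (Laurent n ℂ)ˣ) - ((yvar ℂ j)⁻¹ : (Laurent n ℂ)ˣ) : Laurent n ℂ) →
      σ j = 1

theorem mem_stabSigns {g : Laurent n ℂ} {σ : Fin n → ℤˣ} : σ ∈ stabSigns g ↔ g ∣ conj σ g := by
  simp [stabSigns]

theorem mem_fiberSigns {g : Laurent n ℂ} {σ : Fin n → ℤˣ} : σ ∈ fiberSigns g ↔ g ∣ conj σ g ∧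
    ∀ j, g ∣ ((yvar ℂ j : (Laurent n ℂ)ˣ) - ((yvar ℂ j)⁻¹ : (Laurent n ℂ)ˣ) : Laurent n ℂ) →
      σ j = 1 := by
  simp [fiberSigns, mem_stabSigns]

theorem zpow_units_injective {G : Type*} [Group G] {u : G} (hu : u ≠ u⁻¹) :
    Function.Injective fun s : ℤˣ => u ^ (s : ℤ) := by
  intro s t hst
  have := flip_injective (n := 1) (u := fun _ => u) (fun _ => hu)
    (a₁ := fun _ => s) (a₂ := fun _ => t) (funext fun _ => hst)
  exact congrFun this 0

theorem evalLaurent_yvar_sub_inv (y : Fin n → ℂˣ) (j : Fin n) :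
    evalLaurent y ((yvar ℂ j : (Laurent n ℂ)ˣ) - ((yvar ℂ j)⁻¹ : (Laurent n ℂ)ˣ) : Laurent n ℂ) = 0 ↔
      y j = (y j)⁻¹ := by
  rw [map_sub, evalLaurent_yvar, evalLaurent_yvar_inv, sub_eq_zero]
  exact Units.ext_iff.symm

/-- Genericity conditions on the torus part of the toric variety can be tested on its image. -/
theorem exists_generic {g : Laurent n ℂ} (hg : Prime g) :
    ∃ p : MvPolynomial (Fin n) ℂ, ¬ g ∣ cosHom n p ∧ ∀ y : Fin n → ℂˣ, evalLaurent y g = 0 →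
      eval (cosPoint y) p ≠ 0 → (∀ σ, evalLaurent y (conj σ g) = 0 → g ∣ conj σ g) ∧
        ∀ j, y j = (y j)⁻¹ → g ∣ ((yvar ℂ j : (Laurent n ℂ)ˣ) -
          ((yvar ℂ j)⁻¹ : (Laurent n ℂ)ˣ) : Laurent n ℂ) := by
  classical
  let w : Fin n → Laurent n ℂ := fun j =>
    (yvar ℂ j : (Laurent n ℂ)ˣ) - ((yvar ℂ j)⁻¹ : (Laurent n ℂ)ˣ)
  -- The product of all those conjugates and differences that `g` does not divide; where it is
  -- nonzero, only the forced vanishings occur.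
  let q : Laurent n ℂ := (∏ σ : Fin n → ℤˣ, if g ∣ conj σ g then 1 else conj σ g) *
    ∏ j, if g ∣ w j then 1 else w j
  have hq : ¬ g ∣ q := by
    intro h
    rcases hg.dvd_or_dvd h with h | h
    · obtain ⟨σ, -, hσ⟩ := hg.exists_mem_finset_dvd h
      split_ifs at hσ with h1
      · exact hg.not_isUnit (isUnit_of_dvd_one hσ)
      · exact h1 hσ
    · obtain ⟨j, -, hj⟩ := hg.exists_mem_finset_dvd h
      split_ifs at hj with h1
      · exact hg.not_isUnit (isUnit_of_dvd_one hj)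
      · exact h1 hj
  have : (Ideal.span {g}).IsPrime := (Ideal.span_singleton_prime hg.ne_zero).2 hg
  obtain ⟨p, r, hp, hpr⟩ := exists_cosHom_sub_mem (Ideal.span {g})
    (q := q) (by rwa [Ideal.mem_span_singleton])
  rw [Ideal.mem_span_singleton] at hp hpr
  refine ⟨p, hp, fun y hy hpy => ?_⟩
  -- Modulo `g`, the pullback of `p` is a multiple of `q`.
  have hqy : evalLaurent y q ≠ 0 := by
    obtain ⟨s, hs⟩ := hpr
    intro h0
    have := congrArg (evalLaurent (R := ℂ) y) hs
    rw [map_sub, map_mul _ q r, map_mul _ g s, hy, h0, evalLaurent_cosHom] at this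
    exact hpy (by simpa using this)
  rw [map_mul, map_prod, map_prod] at hqy
  have hq1 := Finset.prod_ne_zero_iff.1 (left_ne_zero_of_mul hqy)
  have hq2 := Finset.prod_ne_zero_iff.1 (right_ne_zero_of_mul hqy)
  constructor
  · intro σ hσ
    by_contra h
    have := hq1 σ (Finset.mem_univ _)
    rw [if_neg h] at this
    exact this hσ
  · intro j hj
    by_contra h
    have := hq2 j (Finset.mem_univ _)
    rw [if_neg h] at this
    exact this ((evalLaurent_yvar_sub_inv y j).2 hj)

variable (A : Matrix (Fin d) (Fin n) ℤ) (b : Fin n → ℂ)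

theorem dvd_cosHom_iff {g : Laurent n ℂ}
    (hg : RingHom.ker (toricHom A (betaUnit b)) = Ideal.span {g}) (p : MvPolynomial (Fin n) ℂ) :
    g ∣ cosHom n p ↔ p ∈ vanishingIdeal ℂ (lissajous A b) := by
  rw [mem_vanishingIdeal_lissajous_iff, ← RingHom.mem_ker, hg, Ideal.mem_span_singleton]

/-- Nonempty basic open subsets thus become nondivisibility by the prime `g`, so any two of them
meet. -/
theorem exists_eval_ne_zero_iff {g : Laurent n ℂ}
    (hg : RingHom.ker (toricHom A (betaUnit b)) = Ideal.span {g}) (p : MvPolynomial (Fin n) ℂ) :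
    (∃ x ∈ lissajous A b, eval x p ≠ 0) ↔ ¬ g ∣ cosHom n p := by
  rw [dvd_cosHom_iff A b hg, mem_vanishingIdeal_iff]
  push Not
  rfl

/-- Over a generic point the fiber is an orbit of one parametrised `y` under `stabSigns g`. Signs at
coordinates with `yⱼ = yⱼ⁻¹` have no effect, and normalising them to `1` makes the labelling
injective. -/
theorem isDegree_fiberSigns {g : Laurent n ℂ} (hgp : Prime g)
    (hg : RingHom.ker (toricHom A (betaUnit b)) = Ideal.span {g}) :
    IsDegree (incidenceVariety A b) Prod.fst (lissajous A b) (fiberSigns g).card := by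
  classical
  obtain ⟨p, hp, hgen⟩ := exists_generic hgp
  refine ⟨p, (exists_eval_ne_zero_iff A b hg p).2 hp, ?_⟩
  rw [lissajous_eq_range]
  rintro _ ⟨v, rfl⟩ hpv
  set y := torusParam A (betaUnit b) v with hy
  have hker : ∀ h, g ∣ h → evalLaurent y h = 0 := fun h hh =>
    (toricHom_eq_zero_iff _ _).1 (by
      rwa [← RingHom.mem_ker, hg, Ideal.mem_span_singleton]) v
  obtain ⟨h1, h2⟩ := hgen y (hker g dvd_rfl) hpv
  have hset : {q ∈ incidenceVariety A b | q.1 = cosPoint y} =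
      (fun σ => (cosPoint y, flip σ y)) '' (fiberSigns g : Set (Fin n → ℤˣ)) := by
    ext ⟨x, z⟩
    constructor
    · rintro ⟨⟨hz1, hz2⟩, hx⟩
      have hxz : x = cosPoint z := funext hz2
      have hx' : x = cosPoint y := hx
      obtain ⟨σ, rfl⟩ := exists_flip_of_cosPoint_eq (hxz.symm.trans hx')
      -- The normalised representative: ineffective signs are reset to `1`.
      let τ : Fin n → ℤˣ := fun j => if y j = (y j)⁻¹ then 1 else σ j
      have hτ : flip τ y = flip σ y := by
        funext j
        by_cases hj : y j = (y j)⁻¹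
        · have hτj : τ j = 1 := if_pos hj
          rcases Int.units_eq_one_or (σ j) with h | h
          · simp [flip, hτj, h]
          · simp only [flip, hτj, h, Units.val_one, Units.val_neg, zpow_one, zpow_neg]
            exact hj
        · have hτj : τ j = σ j := if_neg hj
          simp [flip, hτj]
      refine ⟨τ, mem_fiberSigns.2 ⟨h1 τ ?_, fun j hj => ?_⟩, ?_⟩
      · rw [evalLaurent_conj, hτ]
        exact (mem_toric_iff_of_span A (betaUnit b) hg _).1 hz1
      · exact if_pos ((evalLaurent_yvar_sub_inv y j).1 (hker _ hj))
      · simp only [hτ, hx']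
    · rintro ⟨σ, hσ, h⟩
      obtain ⟨rfl, rfl⟩ := Prod.mk.inj h
      refine ⟨⟨(mem_toric_iff_of_span A (betaUnit b) hg _).2 ?_, fun j => ?_⟩, rfl⟩
      · rw [← evalLaurent_conj]
        exact hker _ (mem_fiberSigns.1 hσ).1
      · exact (congrFun (cosPoint_flip σ y) j).symm
  rw [hset, Set.InjOn.encard_image, Set.encard_coe_eq_coe_finsetCard]
  intro σ hσ τ hτ hστ
  funext j
  by_cases hj : y j = (y j)⁻¹
  · rw [(mem_fiberSigns.1 hσ).2 j (h2 j hj), (mem_fiberSigns.1 hτ).2 j (h2 j hj)]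
  · exact zpow_units_injective hj (congrFun (Prod.mk.inj hστ).2 j)

theorem isDegree_iff {g : Laurent n ℂ} (hgp : Prime g)
    (hg : RingHom.ker (toricHom A (betaUnit b)) = Ideal.span {g}) (m : ℕ) :
    IsDegree (incidenceVariety A b) Prod.fst (lissajous A b) m ↔ m = (fiberSigns g).card := by
  constructor
  · rintro ⟨p, hp, hpm⟩
    obtain ⟨q, hq, hqm⟩ := isDegree_fiberSigns A b hgp hg
    rw [exists_eval_ne_zero_iff A b hg] at hp hq
    have hpq : ¬ g ∣ cosHom n (p * q) := by
      rw [map_mul]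
      exact fun h => (hgp.dvd_or_dvd h).elim hp hq
    obtain ⟨x, hx, hxpq⟩ := (exists_eval_ne_zero_iff A b hg _).2 hpq
    rw [map_mul] at hxpq
    have h1 := hpm x hx (left_ne_zero_of_mul hxpq)
    have h2 := hqm x hx (right_ne_zero_of_mul hxpq)
    exact_mod_cast h1.symm.trans h2
  · rintro rfl
    exact isDegree_fiberSigns A b hgp hg

end Degree

/-! ### Euler derivations and the chain rule -/

section Euler

variable {n : ℕ}

/-- The Euler derivation `yⱼ ∂/∂yⱼ`. -/
def eulerDeriv (j : Fin n) : Laurent n ℂ →ₗ[ℂ] Laurent n ℂ :=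
  (AddMonoidAlgebra.basis (Fin n → ℤ) ℂ).constr ℂ fun m => (m j : ℂ) • mono ℂ m

theorem eulerDeriv_mono (j : Fin n) (m : Fin n → ℤ) :
    eulerDeriv j (mono ℂ m) = (m j : ℂ) • mono ℂ m :=
  (AddMonoidAlgebra.basis (Fin n → ℤ) ℂ).constr_basis ℂ _ m

theorem eulerDeriv_mul (j : Fin n) (f g : Laurent n ℂ) :
    eulerDeriv j (f * g) = f * eulerDeriv j g + g * eulerDeriv j f := by
  induction f using AddMonoidAlgebra.induction_linear with
  | zero => simp
  | add p q hp hq => rw [add_mul, map_add, hp, hq, map_add]; ring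
  | single m r =>
    induction g using AddMonoidAlgebra.induction_linear with
    | zero => simp
    | add p q hp hq => rw [mul_add, map_add, hp, hq, map_add]; ring
    | single k s =>
      rw [single_eq_smul_mono, single_eq_smul_mono, smul_mul_smul_comm, ← mono_add, map_smul,
        map_smul, map_smul, eulerDeriv_mono, eulerDeriv_mono, eulerDeriv_mono, mono_add,
        Pi.add_apply, Int.cast_add]
      simp only [Algebra.smul_def, map_add, map_mul]
      ring

theorem eulerDeriv_algebraMap (j : Fin n) (c : ℂ) :
    eulerDeriv j (algebraMap ℂ (Laurent n ℂ) c) = 0 := by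
  rw [Algebra.algebraMap_eq_smul_one, ← mono_zero, map_smul, eulerDeriv_mono]
  simp

/-- The chain rule; the factor `(yⱼ - yⱼ⁻¹)/2` detects ramification of the cosine substitution. -/
theorem eulerDeriv_cosHom (j : Fin n) (p : MvPolynomial (Fin n) ℂ) :
    eulerDeriv j (cosHom n p) = cosHom n (pderiv j p) * ((2⁻¹ : ℂ) •
      ((yvar ℂ j : (Laurent n ℂ)ˣ) - ((yvar ℂ j)⁻¹ : (Laurent n ℂ)ˣ) : Laurent n ℂ)) := by
  induction p using MvPolynomial.induction_on with
  | C a =>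
    rw [pderiv_C, map_zero, zero_mul]
    exact (congrArg _ ((cosHom n).commutes a)).trans (eulerDeriv_algebraMap j a)
  | add p q hp hq => rw [map_add, map_add, hp, hq, map_add, map_add, add_mul]
  | mul_X p i hp =>
    have hX : eulerDeriv j (cosHom n (X i)) = cosHom n (pderiv j (X i)) * ((2⁻¹ : ℂ) •
        ((yvar ℂ j : (Laurent n ℂ)ˣ) - ((yvar ℂ j)⁻¹ : (Laurent n ℂ)ˣ) : Laurent n ℂ)) := by
      have h1 : cosHom n (X i) =
          (2⁻¹ : ℂ) • (mono ℂ (Pi.single i 1) + mono ℂ (Pi.single i (-1))) := by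
        rw [cosHom, aeval_X]; rfl
      rw [h1, map_smul, map_add, eulerDeriv_mono, eulerDeriv_mono]
      by_cases hij : i = j
      · subst hij
        rw [pderiv_X_self, map_one, one_mul]
        simp [yvar, sub_eq_add_neg]
      · rw [pderiv_X_of_ne hij]
        simp [Pi.single_eq_of_ne (Ne.symm hij)]
    rw [map_mul, eulerDeriv_mul, hp, hX, pderiv_mul, map_add, map_mul, map_mul]
    ring

/-- A nonconstant polynomial has a partial derivative which it does not divide. -/
theorem exists_not_dvd_pderiv {f : MvPolynomial (Fin n) ℂ} (hf0 : f ≠ 0) (hf : ¬ IsUnit f) :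
    ∃ j, ¬ f ∣ pderiv j f := by
  have hdeg : f.totalDegree ≠ 0 := by
    intro h
    rw [totalDegree_eq_zero_iff_eq_C] at h
    apply hf
    rw [h]
    refine (isUnit_iff_ne_zero.2 fun h0 => hf0 ?_).map C
    rw [h, h0, C_0]
  obtain ⟨m, hm, hmdeg⟩ : ∃ m ∈ f.support, (m.sum fun _ e => e) ≠ 0 := by
    by_contra! hno
    apply hdeg
    rw [← Nat.le_zero]
    exact Finset.sup_le fun m hm => (hno m hm).le
  obtain ⟨j, hj⟩ : ∃ j, m j ≠ 0 := by
    by_contra! hno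
    exact hmdeg (Finset.sum_eq_zero fun j _ => hno j)
  refine ⟨j, fun ⟨q, hq⟩ => ?_⟩
  have hmj : m - Finsupp.single j 1 + Finsupp.single j 1 = m :=
    tsub_add_cancel_of_le (Finsupp.single_le_iff.2 (Nat.one_le_iff_ne_zero.2 hj))
  -- In characteristic zero the monomial `m` with `m j ≠ 0` survives differentiation. The derivative
  -- then has smaller degree than `f`, so it cannot be a nonzero multiple of `f`.
  have hne : pderiv j f ≠ 0 := by
    intro h0
    have := congrArg (coeff (m - Finsupp.single j 1)) h0
    rw [coeff_pderiv, hmj, coeff_zero] at this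
    exact (mul_ne_zero (mem_support_iff.1 hm) (Nat.cast_add_one_ne_zero _)) this
  have hlt : (pderiv j f).totalDegree + 1 ≤ f.totalDegree := by
    obtain ⟨k, hk, hkdeg⟩ : ∃ k ∈ (pderiv j f).support,
        (pderiv j f).totalDegree = k.sum fun _ e => e :=
      Finset.exists_mem_eq_sup _ (support_nonempty.2 hne) _
    have hk' : k + Finsupp.single j 1 ∈ f.support := by
      rw [mem_support_iff] at hk ⊢
      rw [coeff_pderiv] at hk
      exact left_ne_zero_of_mul hk
    have := le_totalDegree hk'
    rw [Finsupp.sum_add_index' (fun _ => rfl) (fun _ _ _ => rfl), ← hkdeg] at this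
    simpa using this
  rw [hq] at hne hlt
  rw [totalDegree_mul_of_isDomain hf0 (right_ne_zero_of_mul hne)] at hlt
  omega

end Euler

/-! ### Multiplicities of the prime `g` -/

section Multiplicity

theorem le_of_pow_mul_dvd {R : Type*} [CommRing R] [IsDomain R] {g a b : R} (hg : Prime g)
    (ha : ¬ g ∣ a) {m k : ℕ} (h : g ^ k * b ∣ g ^ m * a) : k ≤ m := by
  by_contra! hlt
  apply ha
  have h1 : g ^ (m + 1) ∣ g ^ m * a := (pow_dvd_pow g hlt).trans ((dvd_mul_right _ _).trans h)
  rw [pow_succ] at h1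
  exact (mul_dvd_mul_iff_left (pow_ne_zero m hg.ne_zero)).1 h1

theorem eq_of_associated_pow_mul {R : Type*} [CommRing R] [IsDomain R] {g a b : R} (hg : Prime g)
    (ha : ¬ g ∣ a) (hb : ¬ g ∣ b) {m k : ℕ} (h : Associated (g ^ m * a) (g ^ k * b)) : m = k :=
  le_antisymm (le_of_pow_mul_dvd hg hb h.dvd) (le_of_pow_mul_dvd hg ha h.dvd')

variable {n : ℕ}

/-- Conjugation by `σ` is an involution, so applying it reverses the divisibility. -/
theorem associated_conj {g : Laurent n ℂ} {σ : Fin n → ℤˣ} (h : g ∣ conj σ g) :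
    Associated g (conj σ g) := by
  apply associated_of_dvd_dvd h
  have h1 := map_dvd (conj σ) h
  rwa [conj_conj, show σ * σ = 1 from funext fun j => Int.units_mul_self _, conj_one] at h1

/-- In the norm, conjugates indexed by `stabSigns g` are associates of `g`; the others are prime to
`g`. -/
theorem exists_cosHom_det_associated {g : Laurent n ℂ} (hg : Prime g) :
    ∃ q, ¬ g ∣ q ∧ Associated (cosHom n (stdMatrix g).det) (g ^ (stabSigns g).card * q) := by
  classical
  refine ⟨∏ σ ∈ Finset.univ.filter fun σ => ¬ g ∣ conj σ g, conj σ g, fun h => ?_, ?_⟩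
  · obtain ⟨σ, hσ, h⟩ := hg.exists_mem_finset_dvd h
    exact (Finset.mem_filter.1 hσ).2 h
  · rw [cosHom_det_stdMatrix, ← Finset.prod_filter_mul_prod_filter_not _ fun σ => g ∣ conj σ g]
    apply Associated.mul_right
    rw [← Finset.prod_const]
    have hS : Finset.univ.filter (fun σ => g ∣ conj σ g) = stabSigns g := by
      ext σ; simp [mem_stabSigns]
    rw [hS]
    exact Associated.prod _ _ _ fun σ hσ => (associated_conj (mem_stabSigns.1 hσ)).symm

/-- Multiplicity of `g` in `f(cos)` when there is no ramification. -/
theorem not_sq_dvd_cosHom {g : Laurent n ℂ} (hg : Prime g) {f : MvPolynomial (Fin n) ℂ}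
    (hf : Prime f) (hfg : ∀ p, g ∣ cosHom n p → f ∣ p)
    (hne : ∀ j, ¬ g ∣ ((yvar ℂ j : (Laurent n ℂ)ˣ) - ((yvar ℂ j)⁻¹ : (Laurent n ℂ)ˣ) :
      Laurent n ℂ)) : ¬ g ^ 2 ∣ cosHom n f := by
  rintro ⟨h, hh⟩
  obtain ⟨j, hj⟩ := exists_not_dvd_pderiv hf.ne_zero hf.not_isUnit
  have h1 := eulerDeriv_cosHom j f
  rw [hh, pow_two, mul_assoc, eulerDeriv_mul] at h1
  -- A square factor `g²` leaves a factor `g` in the derivative. As `g` is prime, either `f` divides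
  -- its own partial derivative or there is ramification.
  have h2 : g ∣ cosHom n (pderiv j f) * ((2⁻¹ : ℂ) •
      ((yvar ℂ j : (Laurent n ℂ)ˣ) - ((yvar ℂ j)⁻¹ : (Laurent n ℂ)ˣ) : Laurent n ℂ)) := by
    rw [← h1, eulerDeriv_mul, mul_assoc]
    exact dvd_add (dvd_mul_right _ _) (dvd_mul_right _ _)
  rcases hg.dvd_or_dvd h2 with h3 | h3
  · exact hj (hfg _ h3)
  · apply hne j
    have h4 := h3.mul_left (algebraMap ℂ (Laurent n ℂ) 2)
    rwa [← Algebra.smul_def, smul_smul, mul_inv_cancel₀ two_ne_zero, one_smul] at h4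

end Multiplicity

/-! ### The ramified case -/

section Ramified

variable {n : ℕ}

/-- The variable `yⱼ` minus a constant is prime. -/
theorem prime_yvar_sub (j : Fin n) (c : ℂˣ) :
    Prime ((yvar ℂ j : (Laurent n ℂ)ˣ) - algebraMap ℂ (Laurent n ℂ) c) := by
  set w : Laurent n ℂ := (yvar ℂ j : (Laurent n ℂ)ˣ) - algebraMap ℂ (Laurent n ℂ) c with hw
  let cu : (Laurent n ℂ)ˣ := Units.map (algebraMap ℂ (Laurent n ℂ) : ℂ →* Laurent n ℂ) c
  let θ : Laurent n ℂ →ₐ[ℂ] Laurent n ℂ := evalLaurent (Function.update (yvar ℂ) j cu)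
  -- Setting `yⱼ = c` changes nothing modulo `w`, so the kernel of `θ` is generated by `w`; it is
  -- prime because the target is a domain.
  have hquot : (Ideal.Quotient.mkₐ ℂ (Ideal.span {w})).comp θ = Ideal.Quotient.mkₐ ℂ _ := by
    apply algHom_ext_yvar
    intro i
    rw [AlgHom.comp_apply, evalLaurent_yvar]
    by_cases hi : i = j
    · subst hi
      rw [Function.update_self, eq_comm, Ideal.Quotient.mkₐ_eq_mk, Ideal.Quotient.eq]
      exact Ideal.mem_span_singleton_self _
    · rw [Function.update_of_ne hi]
  have hθw : θ w = 0 := by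
    rw [hw, map_sub, evalLaurent_yvar, Function.update_self, AlgHom.commutes]
    exact sub_self _
  have hker : RingHom.ker θ = Ideal.span {w} := by
    apply le_antisymm
    · intro h hh
      rw [← Ideal.Quotient.eq_zero_iff_mem]
      have := DFunLike.congr_fun hquot h
      rw [AlgHom.comp_apply, (RingHom.mem_ker).1 hh, map_zero] at this
      exact this.symm
    · rw [Ideal.span_le, Set.singleton_subset_iff]
      exact hθw
  have hw0 : w ≠ 0 := by
    intro h0
    have h1 := congrArg (evalLaurent (R := ℂ) fun _ : Fin n => c * Units.mk0 2 two_ne_zero) h0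
    rw [hw, map_sub, evalLaurent_yvar, AlgHom.commutes, map_zero] at h1
    have h2 : (c : ℂ) * 2 - c = 0 := h1
    exact c.ne_zero (by linear_combination h2)
  rw [← Ideal.span_singleton_prime hw0, ← hker]
  exact RingHom.ker_isPrime _

theorem irreducible_X_sub_C (j : Fin n) (c : ℂ) :
    Irreducible (X j - C c : MvPolynomial (Fin n) ℂ) := by
  have := irreducible_mul_X_add (1 : MvPolynomial (Fin n) ℂ) (-C c) j one_ne_zero (by simp)
    (by rw [vars_neg, vars_C]; simp) isRelPrime_one_left
  rwa [one_mul, ← sub_eq_add_neg] at this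

/-- For `c² = 1`, `yⱼ (yⱼ + yⱼ⁻¹ - 2c) = (yⱼ - c)²`. -/
theorem cosHom_X_sub_C (j : Fin n) {c : ℂˣ} (hc : c * c = 1) :
    Associated (cosHom n (X j - C (c : ℂ)))
      (((yvar ℂ j : (Laurent n ℂ)ˣ) - algebraMap ℂ (Laurent n ℂ) c) ^ 2) := by
  have h2 : IsUnit (algebraMap ℂ (Laurent n ℂ) 2) :=
    (isUnit_iff_ne_zero.2 (two_ne_zero : (2 : ℂ) ≠ 0)).map _
  refine Associated.trans (y := algebraMap ℂ (Laurent n ℂ) 2 * cosHom n (X j - C (c : ℂ)))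
    ⟨h2.unit, mul_comm _ _⟩ ?_
  refine ⟨yvar ℂ j, ?_⟩
  have h3 : cosHom n (C (c : ℂ)) = algebraMap ℂ (Laurent n ℂ) c := (cosHom n).commutes _
  have hc' : algebraMap ℂ (Laurent n ℂ) c * algebraMap ℂ (Laurent n ℂ) c = 1 := by
    rw [← map_mul, ← Units.val_mul, hc, Units.val_one, map_one]
  rw [map_sub, h3, mul_sub, map_ofNat, two_mul_cosHom_X]
  linear_combination (Units.mul_inv (yvar ℂ j)) - hc'

/-- For `c² = 1`, `yⱼ⁻¹ - c = -c yⱼ⁻¹ (yⱼ - c)`. -/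
theorem yvar_sub_dvd_conj (j : Fin n) {c : ℂˣ} (hc : c * c = 1) (σ : Fin n → ℤˣ) :
    ((yvar ℂ j : (Laurent n ℂ)ˣ) - algebraMap ℂ (Laurent n ℂ) c : Laurent n ℂ) ∣
      conj σ ((yvar ℂ j : (Laurent n ℂ)ˣ) - algebraMap ℂ (Laurent n ℂ) c) := by
  have hc' : algebraMap ℂ (Laurent n ℂ) c * algebraMap ℂ (Laurent n ℂ) c = 1 := by
    rw [← map_mul, ← Units.val_mul, hc, Units.val_one, map_one]
  rw [conj, map_sub, evalLaurent_yvar, AlgHom.commutes, flip]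
  rcases Int.units_eq_one_or (σ j) with h | h
  · rw [h]; simp
  · rw [h]
    refine ⟨-(algebraMap ℂ (Laurent n ℂ) c * ((yvar ℂ j)⁻¹ : (Laurent n ℂ)ˣ)), ?_⟩
    simp only [Units.val_neg, Units.val_one, zpow_neg, zpow_one]
    linear_combination (algebraMap ℂ (Laurent n ℂ) c) * (Units.mul_inv (yvar ℂ j)) -
      ((yvar ℂ j)⁻¹ : (Laurent n ℂ)ˣ) * hc'

/-- In the ramified case `g` is a variable minus a sign, up to a unit. -/
theorem exists_associated_yvar_sub {g : Laurent n ℂ} (hg : Prime g) {j : Fin n}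
    (hj : g ∣ ((yvar ℂ j : (Laurent n ℂ)ˣ) - ((yvar ℂ j)⁻¹ : (Laurent n ℂ)ˣ) : Laurent n ℂ)) :
    ∃ c : ℂˣ, c * c = 1 ∧
      Associated g ((yvar ℂ j : (Laurent n ℂ)ˣ) - algebraMap ℂ (Laurent n ℂ) c) := by
  have h1 : g ∣ ((yvar ℂ j : (Laurent n ℂ)ˣ) - algebraMap ℂ (Laurent n ℂ) ((1 : ℂˣ) : ℂ)) *
      ((yvar ℂ j : (Laurent n ℂ)ˣ) - algebraMap ℂ (Laurent n ℂ) ((-1 : ℂˣ) : ℂ)) := by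
    have := hj.mul_left ((yvar ℂ j : (Laurent n ℂ)ˣ) : Laurent n ℂ)
    rw [mul_sub, Units.mul_inv] at this
    simp only [Units.val_one, Units.val_neg, map_neg, map_one]
    convert this using 1
    ring
  rcases hg.dvd_or_dvd h1 with h | h
  · exact ⟨1, by simp, hg.associated_of_dvd (prime_yvar_sub j 1) h⟩
  · exact ⟨-1, by simp, hg.associated_of_dvd (prime_yvar_sub j (-1)) h⟩

/-- Every sign vector stabilises `g`, and `j` is the only ramified coordinate, so `fiberSigns g` is
the half with `σ j = 1`. -/
theorem stabSigns_card_of_ramified {g : Laurent n ℂ} {j : Fin n} {c : ℂˣ} (hc : c * c = 1)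
    (hgc : Associated g ((yvar ℂ j : (Laurent n ℂ)ˣ) - algebraMap ℂ (Laurent n ℂ) c)) :
    (stabSigns g).card = (fiberSigns g).card * 2 := by
  classical
  have hS : ∀ σ, g ∣ conj σ g := fun σ =>
    hgc.dvd.trans ((yvar_sub_dvd_conj j hc σ).trans (map_dvd (conj σ) hgc.dvd'))
  have hJ : ∀ i, g ∣ ((yvar ℂ i : (Laurent n ℂ)ˣ) - ((yvar ℂ i)⁻¹ : (Laurent n ℂ)ˣ) : Laurent n ℂ) ↔
      i = j := by
    intro i
    constructor
    · intro hi
      by_contra hij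
      -- A zero of `g` at which `yᵢ = 2` for every `i ≠ j`, so `yᵢ ≠ yᵢ⁻¹` there.
      let u : Fin n → ℂˣ := Function.update (fun _ => Units.mk0 2 two_ne_zero) j c
      have hgu : evalLaurent u g = 0 := by
        obtain ⟨r, hr⟩ := hgc.dvd'
        rw [hr, map_mul, map_sub, evalLaurent_yvar, AlgHom.commutes]
        simp [u]
      have h1 : u i = (u i)⁻¹ := by
        rw [← evalLaurent_yvar_sub_inv]
        obtain ⟨r, hr⟩ := hi
        rw [hr, map_mul, hgu, zero_mul]
      have h2 := congrArg Units.val h1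
      simp only [u, Function.update_of_ne hij, Units.val_inv_eq_inv_val, Units.val_mk0] at h2
      norm_num at h2
    · rintro rfl
      refine hgc.dvd.trans ⟨((yvar ℂ i)⁻¹ : (Laurent n ℂ)ˣ) *
        ((yvar ℂ i : (Laurent n ℂ)ˣ) + algebraMap ℂ (Laurent n ℂ) c), ?_⟩
      have hc' : algebraMap ℂ (Laurent n ℂ) c * algebraMap ℂ (Laurent n ℂ) c = 1 := by
        rw [← map_mul, ← Units.val_mul, hc, Units.val_one, map_one]
      linear_combination ((yvar ℂ i)⁻¹ : (Laurent n ℂ)ˣ) * hc' -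
        (yvar ℂ i : (Laurent n ℂ)ˣ) * (Units.mul_inv (yvar ℂ i))
  have h1 : stabSigns g = Finset.univ := by
    ext σ; simp [mem_stabSigns, hS]
  have h2 : fiberSigns g = Finset.univ.filter fun σ => σ j = 1 := by
    ext σ; simp [mem_fiberSigns, hS, hJ]
  have h3 : (Finset.univ.filter fun σ : Fin n → ℤˣ => ¬ σ j = 1).card =
      (Finset.univ.filter fun σ : Fin n → ℤˣ => σ j = 1).card := by
    refine Finset.card_equiv (Equiv.mulLeft (Pi.mulSingle j (-1))) fun σ => ?_
    simp only [Finset.mem_filter, Finset.mem_univ, true_and, Equiv.coe_mulLeft, Pi.mul_apply,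
      Pi.mulSingle_eq_same, neg_mul, one_mul]
    rcases Int.units_eq_one_or (σ j) with h | h <;> simp [h]
  rw [h1, h2, ← Finset.card_filter_add_card_filter_not fun σ : Fin n → ℤˣ => σ j = 1, h3, mul_two]

end Ramified

/-! ### The exponent of `f` in the determinant -/

section Main

variable {d n : ℕ} (A : Matrix (Fin d) (Fin n) ℤ) (b : Fin n → ℂ)

/-- Equal zero sets and primality of `f` make the determinant a power `f ^ e` up to a unit; `e`
follows by comparing multiplicities of `g` after the cosine substitution. -/
theorem det_associated_pow {g : Laurent n ℂ} (hgp : Prime g)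
    (hg : RingHom.ker (toricHom A (betaUnit b)) = Ideal.span {g}) {f : MvPolynomial (Fin n) ℂ}
    (hf : vanishingIdeal ℂ (lissajous A b) = Ideal.span {f}) :
    Associated (stdMatrix g).det (f ^ (fiberSigns g).card) := by
  set F := (stdMatrix g).det with hF
  have hdvd : ∀ p, g ∣ cosHom n p ↔ f ∣ p := fun p => by
    rw [dvd_cosHom_iff A b hg, hf, Ideal.mem_span_singleton]
  obtain ⟨q, hq, hFq⟩ := exists_cosHom_det_associated hgp
  have hF0 : F ≠ 0 := by
    rintro h0
    rw [← hF, h0, map_zero] at hFq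
    exact mul_ne_zero (pow_ne_zero _ hgp.ne_zero) (fun h0 => hq (by rw [h0]; exact dvd_zero g))
      ((associated_zero_iff_eq_zero _).1 hFq.symm)
  have hfF : f ∣ F := by
    rw [← Ideal.mem_span_singleton, ← hf, mem_vanishingIdeal_iff]
    intro x hx
    rw [lissajous_eq_zeroLocus_det A b hg] at hx
    exact hx
  have hf0 : f ≠ 0 := fun h => hF0 (zero_dvd_iff.1 (h ▸ hfF))
  -- Divisibility by `f` is divisibility of the pullback by `g`, so primality descends.
  have hfp : Prime f := by
    refine ⟨hf0, fun hu => ?_, fun p r hpr => ?_⟩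
    · have h1 := (hdvd 1).2 (isUnit_iff_dvd_one.1 hu)
      rw [map_one] at h1
      exact hgp.not_isUnit (isUnit_of_dvd_one h1)
    · rw [← hdvd, ← hdvd]
      rw [← hdvd, map_mul] at hpr
      exact hgp.dvd_or_dvd hpr
  obtain ⟨N, hN⟩ : ∃ N, F ∣ f ^ N := by
    have h1 : f ∈ (Ideal.span {F}).radical := by
      rw [← vanishingIdeal_zeroLocus_eq_radical (K := ℂ), mem_vanishingIdeal_iff]
      intro x hx
      have h2 : f ∈ vanishingIdeal ℂ (lissajous A b) := hf ▸ Ideal.mem_span_singleton_self f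
      refine h2 x ?_
      rw [lissajous_eq_zeroLocus_det A b hg]
      exact hx F (Ideal.mem_span_singleton_self F)
    obtain ⟨N, hN⟩ := h1
    exact ⟨N, Ideal.mem_span_singleton.1 hN⟩
  obtain ⟨e, -, he⟩ := (dvd_prime_pow hfp N).1 hN
  have hFe : Associated (cosHom n F) (cosHom n f ^ e) := by
    rw [← map_pow]
    exact he.map (cosHom n)
  suffices h : e = (fiberSigns g).card by rwa [← h]
  by_cases hram : ∃ j, g ∣ ((yvar ℂ j : (Laurent n ℂ)ˣ) - ((yvar ℂ j)⁻¹ : (Laurent n ℂ)ˣ) :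
      Laurent n ℂ)
  · obtain ⟨j, hj⟩ := hram
    obtain ⟨c, hc, hgc⟩ := exists_associated_yvar_sub hgp hj
    have hcos := cosHom_X_sub_C j hc
    have hfj : Associated f (X j - C (c : ℂ)) := by
      refine hfp.irreducible.associated_of_dvd (irreducible_X_sub_C j _) ((hdvd _).1 ?_)
      exact hgc.dvd.trans ((dvd_pow_self _ two_ne_zero).trans hcos.dvd')
    -- The pullback of `f` is an associate of `g²`, so `2 * e = |stabSigns g|`.
    have h1 : Associated (g ^ (2 * e) * 1) (g ^ (stabSigns g).card * q) := by
      rw [mul_one, pow_mul]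
      refine (((hgc.pow_pow).trans hcos.symm).trans
        (hfj.symm.map (cosHom n))).pow_pow.trans (hFe.symm.trans hFq)
    have h2 := eq_of_associated_pow_mul hgp
      (fun h => hgp.not_isUnit (isUnit_of_dvd_one h)) hq h1
    have h3 := stabSigns_card_of_ramified hc hgc
    omega
  · push Not at hram
    obtain ⟨h, hh⟩ := (hdvd f).2 dvd_rfl
    -- Without ramification `g` divides the pullback of `f` exactly once, and `fiberSigns g` is all
    -- of `stabSigns g`.
    have hgh : ¬ g ∣ h := by
      rintro ⟨r, rfl⟩
      exact not_sq_dvd_cosHom hgp hfp (fun p => (hdvd p).1) hram ⟨r, by rw [hh]; ring⟩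
    rw [hh, mul_pow] at hFe
    have h1 := eq_of_associated_pow_mul hgp (fun hd => hgh (hgp.dvd_of_dvd_pow hd)) hq
      (hFe.symm.trans hFq)
    rw [h1]
    congr 1
    ext σ
    simp [mem_stabSigns, mem_fiberSigns, hram]

end Main

end Lissajous

end

theorem mainTheorem4 {d n : ℕ} (A : Matrix (Fin d) (Fin n) ℤ) (b : Fin n → ℂ)
    (hA : (A.map (Int.cast : ℤ → ℚ)).rank + 1 = n)
    (g : Lissajous.Laurent n ℂ)
    (hg : Lissajous.GeneratesToricIdeal A (Lissajous.beta b) g)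
    {ι : Type*} [Fintype ι] [DecidableEq ι]
    (e : Module.Basis ι (Lissajous.FieldK n) (Lissajous.AlgA n))
    (M : Matrix ι ι (MvPolynomial (Fin n) ℂ))
    (hM : Lissajous.IsMultiplicationMatrix e g M) :
    Lissajous.lissajous A b = {x | (M.map (MvPolynomial.eval x)).det = 0} ∧
    ∃ k : ℕ,
      (∀ m : ℕ, Lissajous.IsDegree (Lissajous.incidenceVariety A b) Prod.fst
        (Lissajous.lissajous A b) m ↔ m = k) ∧
      ∀ f : MvPolynomial (Fin n) ℂ,
        MvPolynomial.vanishingIdeal ℂ (Lissajous.lissajous A b) = Ideal.span {f} →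
        ∃ c : ℂ, c ≠ 0 ∧ M.det = MvPolynomial.C c * f ^ k := by
  have hker := Lissajous.ker_toricHom_eq_span A (Lissajous.betaUnit b) hg
  have hgp := Lissajous.prime_generator A (Lissajous.betaUnit b) (by omega) hker
  have hdet := Lissajous.det_eq_det_stdMatrix e hM
  refine ⟨?_, (Lissajous.fiberSigns g).card, Lissajous.isDegree_iff A b hgp hker, fun f hf => ?_⟩
  · rw [Lissajous.lissajous_eq_zeroLocus_det A b hker, ← hdet]
    ext x
    change MvPolynomial.eval x M.det = 0 ↔ (M.map (MvPolynomial.eval x)).det = 0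
    rw [RingHom.map_det]
    rfl
  · obtain ⟨u, hu⟩ := (Lissajous.det_associated_pow A b hgp hker hf).symm
    obtain ⟨c, hc, huc⟩ := MvPolynomial.isUnit_iff_eq_C_of_isReduced.1 u.isUnit
    refine ⟨c, hc.ne_zero, ?_⟩
    rw [hdet, ← hu, huc, mul_comm]
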